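/- All graphs are finite and simple. A HIST of a graph is a spanning tree of it that has no vertex of degree 2. A graph (with at least one vertex) is HIST-critical if it contains no HIST but every subgraph obtained from it by deleting one vertex contains a HIST. Theorem. There are infinitely many (pairwise non-isomorphic) planar HIST-critical graphs. Moreover, there are infinitely many (pairwise non-isomorphic) planar HIST-critical graphs $G$, each containing an edge $e$ such that $G-e$ is 3-connected and HIST-critical. Explicitly, for $k\ge 4$ let $G_k$ be the graph with vertex set $\{a_1,\dots,a_k,b_1,\dots,b_k,c_1,\dots,c_{k-1},x,y\}$ and edge set $\{a_ia_{i+1},\,a_ic_i,\,a_{i+1}c_i,\,b_ib_{i+1},\,b_ic_i,\,b_{i+1}c_i : 1\le i\le k-1\}\cup\{a_1x,\,a_kx,\,b_1y,\,b_ky,\,xy\}$, and let $H_k=G_k+a_1a_k$. Then for every even $k\ge 4$: (a) $G_k$ is planar, 3-connected and HIST-critical; (b) $H_k$ is planar and HIST-critical, $a_1a_k$ is an edge of $H_k$, and $H_k-a_1a_k=G_k$; (c) $G_k$ and $H_k$ have $3k+1$ vertices; the vertices of degree different from 4 are exactly $a_1,a_k,b_1,b_k,x,y$ in $G_k$, and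 exactly $b_1,b_k,x,y$ in $H_k$. -/

import Mathlib

namespace HIST

variable {V : Type*}

/-- The degree of the vertex `v` in `G` (used for finite graphs only). -/
noncomputable def deg (G : SimpleGraph V) (v : V) : ℕ := (G.neighborSet v).ncard

/-- `T` is a HIST of `G`: a spanning tree of `G` without vertices of degree 2. -/
def IsHIST (G T : SimpleGraph V) : Prop :=
  T ≤ G ∧ T.IsTree ∧ ∀ v, deg T v ≠ 2

/-- `G` contains a HIST. -/
def HasHIST (G : SimpleGraph V) : Prop := ∃ T : SimpleGraph V, IsHIST G T

/-- The vertex-deleted subgraph `G - v`. -/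
def deleteVertex (G : SimpleGraph V) (v : V) : SimpleGraph {w : V // w ≠ v} :=
  G.comap Subtype.val

/-- Every vertex-deleted subgraph of `G` contains a HIST. -/
def IsK1Histonian (G : SimpleGraph V) : Prop := ∀ v, HasHIST (deleteVertex G v)

/-- `G` (a graph with at least one vertex) is HIST-free and `K₁`-histonian. -/
def IsHISTCritical (G : SimpleGraph V) : Prop :=
  Nonempty V ∧ ¬ HasHIST G ∧ IsK1Histonian G

/-- `G` is `k`-connected: it has more than `k` vertices, and deleting fewer than `k` vertices
always leaves a connected graph. -/
def IsVertexConnected (k : ℕ) (G : SimpleGraph V) : Prop :=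
  (k : ℕ∞) < ENat.card V ∧
    ∀ S : Finset V, S.card < k → (G.induce {v : V | v ∉ S}).Connected

/-- `G` is planar: its vertices can be placed at distinct points of the Euclidean plane and its
edges drawn as simple arcs joining the ends, such that an arc meets the vertex set in its two
ends only, and two different arcs meet only in common ends. -/
def IsPlanar (G : SimpleGraph V) : Prop :=
  ∃ (pos : V → EuclideanSpace ℝ (Fin 2)) (arc : Sym2 V → Set (EuclideanSpace ℝ (Fin 2))),
    Function.Injective pos ∧
    (∀ u v, G.Adj u v →
      ∃ γ : Path (pos u) (pos v), Function.Injective γ ∧ Set.range γ = arc s(u, v)) ∧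
    (∀ e ∈ G.edgeSet, ∀ w, pos w ∈ arc e → w ∈ e) ∧
    (∀ e ∈ G.edgeSet, ∀ f ∈ G.edgeSet, e ≠ f →
      ∀ p ∈ arc e ∩ arc f, ∃ w, w ∈ e ∧ w ∈ f ∧ pos w = p)

/-- The vertices `a₁, …, a_k, b₁, …, b_k, c₁, …, c_{k-1}, x, y`. Indices are shifted by one:
`a i` with `i : Fin k` is the vertex `a_{i+1}`, and so on. -/
inductive Vert (k : ℕ) : Type
  | a (i : Fin k)
  | b (i : Fin k)
  | c (i : Fin (k - 1))
  | x
  | y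

/-- The edges of `G_k`, each listed in one direction. -/
def edgeRel (k : ℕ) : Vert k → Vert k → Prop
  | .a i, .a j => (j : ℕ) = i + 1
  | .b i, .b j => (j : ℕ) = i + 1
  | .a i, .c j => (i : ℕ) = j ∨ (i : ℕ) = j + 1
  | .b i, .c j => (i : ℕ) = j ∨ (i : ℕ) = j + 1
  | .a i, .x => (i : ℕ) = 0 ∨ (i : ℕ) + 1 = k
  | .b i, .y => (i : ℕ) = 0 ∨ (i : ℕ) + 1 = k
  | .x, .y => True
  | _, _ => False

/-- The graph `G_k`. -/
def graphG (k : ℕ) : SimpleGraph (Vert k) := SimpleGraph.fromRel (edgeRel k)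

/-- The vertex `a₁`. -/
def aFirst {k : ℕ} (hk : 4 ≤ k) : Vert k := .a ⟨0, by omega⟩
/-- The vertex `a_k`. -/
def aLast {k : ℕ} (hk : 4 ≤ k) : Vert k := .a ⟨k - 1, by omega⟩
/-- The vertex `b₁`. -/
def bFirst {k : ℕ} (hk : 4 ≤ k) : Vert k := .b ⟨0, by omega⟩
/-- The vertex `b_k`. -/
def bLast {k : ℕ} (hk : 4 ≤ k) : Vert k := .b ⟨k - 1, by omega⟩

/-- The graph `H_k = G_k + a₁a_k`. -/
def graphH {k : ℕ} (hk : 4 ≤ k) : SimpleGraph (Vert k) :=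
  graphG k ⊔ SimpleGraph.edge (aFirst hk) (aLast hk)

end HIST

namespace HIST

/-! Indices start at 0, as in the code. The graph is a ladder of `k - 1` blocks, each with two
consecutive vertices of either rail and the vertex `c i` between them, closed up by `x`, `y` and, in
`H_k`, the chord between the ends of the `a` rail. Since `G_k ≤ H_k`, a HIST of `G_k` is one of
`H_k`. So it suffices to show that `H_k` has no HIST, and that every vertex-deleted subgraph of
`G_k` has one.

No HIST in `H_k`: cut a hypothetical HIST `T` behind each rung and scan from left to right. What
matters at a cut is the number of edges of `T` going left from the two current rail vertices, the
parity of the number of blocks passed, and whether these two vertices are already joined on the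
left. The left part after `m` blocks has `3m + 2` vertices, and this number minus its number of
edges plays the role of the number of components. The table `potential` bounds it from below, up to
1 if the rail vertices are linked. That the table is correct for the first block (`potential_start`)
and stays correct through every further one (`potential_step`) is a finite check over the local
configurations compatible with the degree condition and without evident cycles. For even `k` the
number of blocks is odd, and `potential_end` says that the edges outside the blocks are then too
few: a spanning tree needs `3k` edges, and `T` falls short. Acyclicity is used only through
triangles, through cycles running over the linked left part and a single block (`not_linked_cycle`),
and through the count of edges.

Vertex-deleted subgraphs: up to the two reflections of `G_k` there are five kinds of deleted vertex.
Each gets an explicit rooted tree, mostly with a rail as spine and the vertices of the other rail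
hung in pairs on every second `c i`; evenness of `k` makes the pairing come out. `hasHIST_of_parent`
turns such a tree into a HIST.

3-connectivity: either one of the two disjoint cycles (a rail with its apex) avoids the deleted set
and everything left attaches to it, or each cycle loses one vertex, and the surviving vertices `c i`
join the two remaining paths.

Planarity: an explicit straight-line drawing of `H_k`, with edges sorted into regions on whose
relevant boundary they have only their ends. -/

/-! ### The finite certificate for the scan along the ladder -/

/-- The degrees allowed in a homeomorphically irreducible tree inside a graph of maximum
degree 4. -/
def okDeg (d : ℕ) : Bool := d == 1 || d == 3 || d == 4

/-- The restrictions that a homeomorphically irreducible tree imposes on one block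
`aᵢ, aᵢ₊₁, bᵢ, bᵢ₊₁, cᵢ` of the ladder: `da`, `db` are the degrees of `aᵢ`, `bᵢ` to the left and
`j` tells that `aᵢ`, `bᵢ` are linked on the left. -/
def blockOk (da db : ℕ) (j aa ac ca bb bc cb : Bool) : Bool :=
  okDeg (ac.toNat + ca.toNat + bc.toNat + cb.toNat) && okDeg (da + aa.toNat + ac.toNat) &&
    okDeg (db + bb.toNat + bc.toNat) && !(aa && ac && ca) && !(bb && bc && cb) &&
    !(j && (ac || aa && ca) && (bc || bb && cb))

/-- Whether `aᵢ₊₁`, `bᵢ₊₁` are linked on the left. -/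
def nextLink (j aa ac ca bb bc cb : Bool) : Bool :=
  ((ca || aa && ac) && (cb || bb && bc)) ||
    (j && (aa || ca && ac) && (bb || cb && bc)) ||
    (j && (aa || ca && ac) && (ac || aa && ca) && cb) ||
    (j && (bb || cb && bc) && (bc || bb && cb) && ca)

/-- A path joining the two rail vertices on the left has to leave each of them by an edge to the
left. This discards impossible states in `potential_step` and `potential_end`. -/
theorem pos_of_nextLink : ∀ j aa ac ca bb bc cb : Bool, nextLink j aa ac ca bb bc cb = true →
    0 < aa.toNat + ca.toNat ∧ 0 < bb.toNat + cb.toNat := by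
  decide

/-- The number of edges in a block. -/
def blockSize (aa ac ca bb bc cb : Bool) : ℕ :=
  aa.toNat + ac.toNat + ca.toNat + bb.toNat + bc.toNat + cb.toNat

/-- A value depending on the unordered pair of degrees `da, db ≤ 2`. -/
def pairTable (v₀₀ v₀₁ v₀₂ v₁₁ v₁₂ : ℕ) : ℕ → ℕ → ℕ
  | 0, 0 => v₀₀
  | 0, 1 => v₀₁
  | 1, 0 => v₀₁
  | 0, 2 => v₀₂
  | 2, 0 => v₀₂
  | 1, 1 => v₁₁
  | 1, 2 => v₁₂
  | 2, 1 => v₁₂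
  -- For degrees up to 2 only the pair `2, 2` lands here, and it never arises behind a block: all of
  -- `aa, ca, bb, cb` would be present, so the vertex `c` has degree 2 or lies in a triangle. The 9
  -- is a dummy.
  | _, _ => 9

/-- A lower bound for the number of components of the left part of the ladder (counting one more
when the two rails are linked), depending on the parity `p` of the length of that part and on the
degrees `da`, `db` to the left of the last two rail vertices. The index `t` distinguishes the
possible degrees to the left of the first two rail vertices. -/
def potential (t : Fin 3) (p : Bool) : ℕ → ℕ → ℕ :=
  match t, p with
  | 0, true => pairTable 4 2 3 2 2
  | 0, false => pairTable 3 2 2 2 3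
  | 1, true => pairTable 4 3 3 2 4
  | 1, false => pairTable 5 2 4 3 3
  | 2, true => pairTable 6 3 5 4 4
  | 2, false => pairTable 5 4 4 3 5

/-- The potential to be used for given degrees to the left of the first two rail vertices. -/
def startType : ℕ → ℕ → Fin 3
  | 0, 0 => 0
  | 2, 0 => 0
  | 1, 1 => 2
  | _, _ => 1

-- A block adds three vertices, so the count of vertices minus edges changes by 3 minus the block
-- size. The terms in `j` and `nextLink` are the correction for linked rails before and after the
-- block.
set_option maxRecDepth 100000 in
theorem potential_step : ∀ (t : Fin 3) (p : Bool) (da db : Fin 3) (j aa ac ca bb bc cb : Bool),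
    (j = true → 0 < (da : ℕ) ∧ 0 < (db : ℕ)) → blockOk da db j aa ac ca bb bc cb = true →
      potential t (!p) (aa.toNat + ca.toNat) (bb.toNat + cb.toNat) +
          blockSize aa ac ca bb bc cb + j.toNat ≤
        potential t p da db + 3 + (nextLink j aa ac ca bb bc cb).toNat := by
  decide +kernel

-- The first block alone has five vertices and nothing linked to its left. The degrees `da`, `db`
-- here come from the edges outside the blocks at the first two rail vertices.
set_option maxRecDepth 100000 in
theorem potential_start : ∀ (da : Fin 3) (db : Fin 2) (aa ac ca bb bc cb : Bool),
    blockOk da db false aa ac ca bb bc cb = true →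
      potential (startType da db) true (aa.toNat + ca.toNat) (bb.toNat + cb.toNat) +
          blockSize aa ac ca bb bc cb ≤
        5 + (nextLink false aa ac ca bb bc cb).toNat := by
  decide +kernel

/-- The restrictions that a homeomorphically irreducible tree imposes on the edges outside the
blocks of the ladder: `da`, `db` are the degrees to the left of the last two rail vertices. -/
def endOk (da db : ℕ) (xy xa₁ xa₂ yb₁ yb₂ aa : Bool) : Bool :=
  okDeg (xy.toNat + xa₁.toNat + xa₂.toNat) && okDeg (xy.toNat + yb₁.toNat + yb₂.toNat) &&
    okDeg (da + (xa₂.toNat + aa.toNat)) && okDeg (db + yb₂.toNat) && !(xa₁ && xa₂ && aa)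

/-- To join the components of the whole ladder and the two vertices `x`, `y` into a tree, one more
outer edge than components is needed. This inequality denies that. The parity is fixed to `true`, an
odd number of blocks; the outer edges at the first rung must agree with the start type chosen at the
beginning. -/
theorem potential_end : ∀ (da db : Fin 3) (j xy xa₁ xa₂ yb₁ yb₂ aa : Bool),
    (j = true → 0 < (da : ℕ) ∧ 0 < (db : ℕ)) → endOk da db xy xa₁ xa₂ yb₁ yb₂ aa = true →
      xy.toNat + xa₁.toNat + xa₂.toNat + yb₁.toNat + yb₂.toNat + aa.toNat + j.toNat <
        potential (startType (xa₁.toNat + aa.toNat) yb₁.toNat) true da db + 1 := by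
  decide +kernel

/-- If all blocks of the ladder are as in a homeomorphically irreducible tree, then the left part
has few edges. -/
theorem ladder_bound (sa sb : ℕ) (hsa : sa ≤ 2) (hsb : sb ≤ 1) (aa ac ca bb bc cb : ℕ → Bool)
    (da db : ℕ → ℕ) (j : ℕ → Bool) (hda : da 0 = sa) (hdb : db 0 = sb) (hj : j 0 = false)
    (hda' : ∀ i, da (i + 1) = (aa i).toNat + (ca i).toNat)
    (hdb' : ∀ i, db (i + 1) = (bb i).toNat + (cb i).toNat)
    (hj' : ∀ i, j (i + 1) = nextLink (j i) (aa i) (ac i) (ca i) (bb i) (bc i) (cb i))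
    (N : ℕ) (hok : ∀ i < N, blockOk (da i) (db i) (j i) (aa i) (ac i) (ca i) (bb i) (bc i) (cb i)) :
    ∀ i, i + 1 ≤ N →
      potential (startType sa sb) (decide (i % 2 = 0)) (da (i + 1)) (db (i + 1)) +
          ∑ m ∈ Finset.range (i + 1), blockSize (aa m) (ac m) (ca m) (bb m) (bc m) (cb m) ≤
        3 * (i + 1) + 2 + (j (i + 1)).toNat := by
  intro i hi
  induction i with
  | zero =>
    have h := potential_start ⟨sa, by omega⟩ ⟨sb, by omega⟩ (aa 0) (ac 0) (ca 0) (bb 0) (bc 0) (cb 0)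
      (by have := hok 0 hi; rwa [hda, hdb, hj] at this)
    simpa [hda', hdb', hj', hj] using h
  | succ i ih =>
    have ih := ih (by omega)
    have ha : da (i + 1) ≤ 2 := by
      rw [hda']; have := Bool.toNat_le (aa i); have := Bool.toNat_le (ca i); omega
    have hb : db (i + 1) ≤ 2 := by
      rw [hdb']; have := Bool.toNat_le (bb i); have := Bool.toNat_le (cb i); omega
    have h := potential_step (startType sa sb) (decide (i % 2 = 0)) ⟨da (i + 1), by omega⟩
      ⟨db (i + 1), by omega⟩ (j (i + 1)) (aa (i + 1)) (ac (i + 1)) (ca (i + 1)) (bb (i + 1))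
      (bc (i + 1)) (cb (i + 1))
      (by
        intro h
        rw [hj'] at h
        simpa only [hda', hdb'] using pos_of_nextLink _ _ _ _ _ _ _ h)
      (hok _ (by omega))
    have hp : (!decide (i % 2 = 0)) = decide ((i + 1) % 2 = 0) := by
      rw [← decide_not]; congr 1; apply propext; omega
    rw [hp] at h
    rw [Finset.sum_range_succ, hda', hdb', hj' (i + 1)]
    simp only at h
    omega

/-! ### Degrees and number of edges of subgraphs of `H_k` -/

/-- The vertices `a` with natural number indices (`x` if out of range). -/
def av (k i : ℕ) : Vert k := if h : i < k then .a ⟨i, h⟩ else .x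
/-- The vertices `b` with natural number indices. -/
def bv (k i : ℕ) : Vert k := if h : i < k then .b ⟨i, h⟩ else .x
/-- The vertices `c` with natural number indices. -/
def cv (k i : ℕ) : Vert k := if h : i < k - 1 then .c ⟨i, h⟩ else .x

theorem av_eq {k i : ℕ} (h : i < k) : av k i = .a ⟨i, h⟩ := dif_pos h
theorem bv_eq {k i : ℕ} (h : i < k) : bv k i = .b ⟨i, h⟩ := dif_pos h
theorem cv_eq {k i : ℕ} (h : i < k - 1) : cv k i = .c ⟨i, h⟩ := dif_pos h

theorem graphG_adj {k : ℕ} {u v : Vert k} :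
    (graphG k).Adj u v ↔ edgeRel k u v ∨ edgeRel k v u := by
  simp only [graphG, SimpleGraph.fromRel_adj, and_iff_right_iff_imp, ne_eq]
  rintro h rfl
  cases u <;> simp [edgeRel] at h

theorem graphH_adj {k : ℕ} (hk : 4 ≤ k) {u v : Vert k} :
    (graphH hk).Adj u v ↔ edgeRel k u v ∨ edgeRel k v u ∨
      (u = aFirst hk ∧ v = aLast hk) ∨ (u = aLast hk ∧ v = aFirst hk) := by
  have : aFirst hk ≠ aLast hk := by simp [aFirst, aLast]; omega
  simp only [graphH, SimpleGraph.sup_adj, SimpleGraph.edge_adj, graphG_adj]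
  constructor
  · tauto
  · rintro (h | h | ⟨rfl, rfl⟩ | ⟨rfl, rfl⟩)
    · tauto
    · tauto
    · simp [this]
    · simp [this.symm]

open Classical in
/-- Adjacency as a Boolean. -/
noncomputable def adjB {V : Type*} (T : SimpleGraph V) (u v : V) : Bool := decide (T.Adj u v)

theorem adjB_iff {V : Type*} {T : SimpleGraph V} {u v : V} : adjB T u v = true ↔ T.Adj u v := by
  simp [adjB]

theorem adjB_comm {V : Type*} (T : SimpleGraph V) (u v : V) : adjB T u v = adjB T v u := by
  simp [adjB, T.adj_comm]

theorem deg_eq_sum {V : Type*} (T : SimpleGraph V) (v : V) (s : Finset V)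
    (hs : ∀ w, T.Adj v w → w ∈ s) : deg T v = ∑ w ∈ s, (adjB T v w).toNat := by
  classical
  have : T.neighborSet v = ↑(s.filter (T.Adj v)) := by
    ext w; simpa using hs w
  rw [deg, this, Set.ncard_coe_finset, Finset.card_filter]
  refine Finset.sum_congr rfl fun w _ => ?_
  by_cases h : T.Adj v w <;> simp [adjB, h]

/-- The edges of the blocks of a subgraph, as Booleans. -/
noncomputable def eAA {k : ℕ} (T : SimpleGraph (Vert k)) (i : ℕ) : Bool :=
  adjB T (av k i) (av k (i + 1))
noncomputable def eAC {k : ℕ} (T : SimpleGraph (Vert k)) (i : ℕ) : Bool :=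
  adjB T (av k i) (cv k i)
noncomputable def eCA {k : ℕ} (T : SimpleGraph (Vert k)) (i : ℕ) : Bool :=
  adjB T (av k (i + 1)) (cv k i)
noncomputable def eBB {k : ℕ} (T : SimpleGraph (Vert k)) (i : ℕ) : Bool :=
  adjB T (bv k i) (bv k (i + 1))
noncomputable def eBC {k : ℕ} (T : SimpleGraph (Vert k)) (i : ℕ) : Bool :=
  adjB T (bv k i) (cv k i)
noncomputable def eCB {k : ℕ} (T : SimpleGraph (Vert k)) (i : ℕ) : Bool :=
  adjB T (bv k (i + 1)) (cv k i)

/-- The degree to the left of `aᵢ`, including the outer edges at `a₀`. -/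
noncomputable def leftA {k : ℕ} (T : SimpleGraph (Vert k)) : ℕ → ℕ
  | 0 => (adjB T .x (av k 0)).toNat + (adjB T (av k 0) (av k (k - 1))).toNat
  | i + 1 => (eAA T i).toNat + (eCA T i).toNat
/-- The degree to the left of `bᵢ`, including the outer edge at `b₀`. -/
noncomputable def leftB {k : ℕ} (T : SimpleGraph (Vert k)) : ℕ → ℕ
  | 0 => (adjB T .y (bv k 0)).toNat
  | i + 1 => (eBB T i).toNat + (eCB T i).toNat

theorem deg_c {k : ℕ} (hk : 4 ≤ k) {T : SimpleGraph (Vert k)} (hT : T ≤ graphH hk) {i : ℕ}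
    (hi : i < k - 1) : deg T (cv k i) =
      (eAC T i).toNat + (eCA T i).toNat + (eBC T i).toNat + (eCB T i).toNat := by
  classical
  rw [deg_eq_sum T _ {av k i, av k (i + 1), bv k i, bv k (i + 1)}]
  · rw [av_eq (i := i) (by omega), av_eq (i := i + 1) (by omega), bv_eq (i := i) (by omega),
      bv_eq (i := i + 1) (by omega), Finset.sum_insert (by simp), Finset.sum_insert (by simp),
      Finset.sum_insert (by simp), Finset.sum_singleton]
    simp only [eAC, eCA, eBC, eCB, adjB_comm T (cv k i)]
    rw [av_eq (i := i) (by omega), av_eq (i := i + 1) (by omega), bv_eq (i := i) (by omega),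
      bv_eq (i := i + 1) (by omega)]
    omega
  · intro w hw
    have := hT hw
    rw [graphH_adj, cv_eq hi] at this
    rw [av_eq (i := i) (by omega), av_eq (i := i + 1) (by omega), bv_eq (i := i) (by omega),
      bv_eq (i := i + 1) (by omega)]
    cases w <;> simp [edgeRel, aFirst, aLast, Fin.ext_iff] at this ⊢ <;> omega

theorem deg_a_mid {k : ℕ} (hk : 4 ≤ k) {T : SimpleGraph (Vert k)} (hT : T ≤ graphH hk) {i : ℕ}
    (hi : i < k - 1) : deg T (av k i) = leftA T i + ((eAA T i).toNat + (eAC T i).toNat) := by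
  classical
  rcases i with _ | i
  · rw [deg_eq_sum T _ {av k 1, cv k 0, .x, av k (k - 1)}]
    · rw [Finset.sum_insert, Finset.sum_insert, Finset.sum_insert, Finset.sum_singleton]
      · simp only [leftA, eAA, eAC, adjB_comm T .x, zero_add]
        omega
      all_goals
        rw [av_eq (i := k - 1) (by omega)]
        try rw [cv_eq hi]
        try rw [av_eq (i := 1) (by omega)]
        simp
        try omega
    · intro w hw
      have := hT hw
      rw [graphH_adj, av_eq (by omega)] at this
      rw [av_eq (i := k - 1) (by omega), cv_eq hi, av_eq (i := 1) (by omega)]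
      cases w <;> simp [edgeRel, aFirst, aLast, Fin.ext_iff] at this ⊢ <;> omega
  · rw [deg_eq_sum T _ {av k (i + 1 + 1), cv k (i + 1), av k i, cv k i}]
    · rw [Finset.sum_insert, Finset.sum_insert, Finset.sum_insert, Finset.sum_singleton]
      · simp only [leftA, eAA, eAC, eCA, adjB_comm T (av k (i + 1)) (av k i)]
        omega
      all_goals
        try rw [cv_eq (i := i) (by omega)]
        try rw [cv_eq (i := i + 1) (by omega)]
        try rw [av_eq (i := i + 1 + 1) (by omega)]
        try rw [av_eq (i := i) (by omega)]
        simp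
        try omega
    · intro w hw
      have := hT hw
      rw [graphH_adj, av_eq (by omega)] at this
      rw [cv_eq (i := i) (by omega), cv_eq (i := i + 1) (by omega),
        av_eq (i := i + 1 + 1) (by omega), av_eq (i := i) (by omega)]
      cases w <;> simp [edgeRel, aFirst, aLast, Fin.ext_iff] at this ⊢ <;> omega

theorem deg_a_last {k : ℕ} (hk : 4 ≤ k) {T : SimpleGraph (Vert k)} (hT : T ≤ graphH hk) :
    deg T (av k (k - 1)) = leftA T (k - 1) +
      ((adjB T .x (av k (k - 1))).toNat + (adjB T (av k 0) (av k (k - 1))).toNat) := by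
  classical
  obtain ⟨n, hn⟩ : ∃ n, k - 1 = n + 1 := ⟨k - 2, by omega⟩
  rw [hn]
  rw [deg_eq_sum T _ {av k n, cv k n, .x, av k 0}]
  · rw [Finset.sum_insert, Finset.sum_insert, Finset.sum_insert, Finset.sum_singleton]
    · simp only [leftA, eAA, eCA, adjB_comm T (av k (n + 1)) (av k n),
        adjB_comm T .x, adjB_comm T (av k 0)]
      omega
    all_goals
      try rw [cv_eq (i := n) (by omega)]
      rw [av_eq (i := 0) (by omega)]
      try rw [av_eq (i := n) (by omega)]
      simp
      try omega
  · intro w hw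
    have := hT hw
    rw [graphH_adj, av_eq (by omega)] at this
    rw [cv_eq (i := n) (by omega), av_eq (i := n) (by omega), av_eq (i := 0) (by omega)]
    cases w <;> simp [edgeRel, aFirst, aLast, Fin.ext_iff] at this ⊢ <;> omega

theorem deg_b_mid {k : ℕ} (hk : 4 ≤ k) {T : SimpleGraph (Vert k)} (hT : T ≤ graphH hk) {i : ℕ}
    (hi : i < k - 1) : deg T (bv k i) = leftB T i + ((eBB T i).toNat + (eBC T i).toNat) := by
  classical
  rcases i with _ | i
  · rw [deg_eq_sum T _ {bv k 1, cv k 0, .y}]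
    · rw [Finset.sum_insert, Finset.sum_insert, Finset.sum_singleton]
      · simp only [leftB, eBB, eBC, adjB_comm T .y, zero_add]
        omega
      all_goals
        rw [cv_eq hi]
        try rw [bv_eq (i := 1) (by omega)]
        simp
    · intro w hw
      have := hT hw
      rw [graphH_adj, bv_eq (by omega)] at this
      rw [cv_eq hi, bv_eq (i := 1) (by omega)]
      cases w <;> simp [edgeRel, aFirst, aLast, Fin.ext_iff] at this ⊢ <;> omega
  · rw [deg_eq_sum T _ {bv k (i + 1 + 1), cv k (i + 1), bv k i, cv k i}]
    · rw [Finset.sum_insert, Finset.sum_insert, Finset.sum_insert, Finset.sum_singleton]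
      · simp only [leftB, eBB, eBC, eCB, adjB_comm T (bv k (i + 1)) (bv k i)]
        omega
      all_goals
        try rw [cv_eq (i := i) (by omega)]
        try rw [cv_eq (i := i + 1) (by omega)]
        try rw [bv_eq (i := i + 1 + 1) (by omega)]
        try rw [bv_eq (i := i) (by omega)]
        simp
        try omega
    · intro w hw
      have := hT hw
      rw [graphH_adj, bv_eq (by omega)] at this
      rw [cv_eq (i := i) (by omega), cv_eq (i := i + 1) (by omega),
        bv_eq (i := i + 1 + 1) (by omega), bv_eq (i := i) (by omega)]
      cases w <;> simp [edgeRel, aFirst, aLast, Fin.ext_iff] at this ⊢ <;> omega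

theorem deg_b_last {k : ℕ} (hk : 4 ≤ k) {T : SimpleGraph (Vert k)} (hT : T ≤ graphH hk) :
    deg T (bv k (k - 1)) = leftB T (k - 1) + (adjB T .y (bv k (k - 1))).toNat := by
  classical
  obtain ⟨n, hn⟩ : ∃ n, k - 1 = n + 1 := ⟨k - 2, by omega⟩
  rw [hn]
  rw [deg_eq_sum T _ {bv k n, cv k n, .y}]
  · rw [Finset.sum_insert, Finset.sum_insert, Finset.sum_singleton]
    · simp only [leftB, eBB, eCB, adjB_comm T (bv k (n + 1)) (bv k n),
        adjB_comm T .y]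
      omega
    all_goals
      rw [cv_eq (i := n) (by omega)]
      try rw [bv_eq (i := n) (by omega)]
      simp
  · intro w hw
    have := hT hw
    rw [graphH_adj, bv_eq (by omega)] at this
    rw [cv_eq (i := n) (by omega), bv_eq (i := n) (by omega)]
    cases w <;> simp [edgeRel, aFirst, aLast, Fin.ext_iff] at this ⊢ <;> omega

theorem deg_x {k : ℕ} (hk : 4 ≤ k) {T : SimpleGraph (Vert k)} (hT : T ≤ graphH hk) :
    deg T .x = (adjB T .x .y).toNat + (adjB T .x (av k 0)).toNat +
      (adjB T .x (av k (k - 1))).toNat := by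
  classical
  rw [deg_eq_sum T _ {.y, av k 0, av k (k - 1)}]
  · rw [Finset.sum_insert, Finset.sum_insert, Finset.sum_singleton, add_assoc]
    all_goals
      rw [av_eq (i := 0) (by omega), av_eq (i := k - 1) (by omega)]
      simp
      try omega
  · intro w hw
    have := hT hw
    rw [graphH_adj] at this
    rw [av_eq (i := 0) (by omega), av_eq (i := k - 1) (by omega)]
    cases w <;> simp [edgeRel, aFirst, aLast, Fin.ext_iff] at this ⊢ <;> omega

theorem deg_y {k : ℕ} (hk : 4 ≤ k) {T : SimpleGraph (Vert k)} (hT : T ≤ graphH hk) :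
    deg T .y = (adjB T .x .y).toNat + (adjB T .y (bv k 0)).toNat +
      (adjB T .y (bv k (k - 1))).toNat := by
  classical
  rw [deg_eq_sum T _ {.x, bv k 0, bv k (k - 1)}]
  · rw [Finset.sum_insert, Finset.sum_insert, Finset.sum_singleton, add_assoc, adjB_comm T .y .x]
    all_goals
      rw [bv_eq (i := 0) (by omega), bv_eq (i := k - 1) (by omega)]
      simp
      try omega
  · intro w hw
    have := hT hw
    rw [graphH_adj] at this
    rw [bv_eq (i := 0) (by omega), bv_eq (i := k - 1) (by omega)]
    cases w <;> simp [edgeRel, aFirst, aLast, Fin.ext_iff] at this ⊢ <;> omega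

/-- The vertices as a disjoint union. -/
def vertEquiv (k : ℕ) : Vert k ≃ (Fin k ⊕ Fin k) ⊕ (Fin (k - 1) ⊕ Bool) where
  toFun
    | .a i => .inl (.inl i)
    | .b i => .inl (.inr i)
    | .c i => .inr (.inl i)
    | .x => .inr (.inr true)
    | .y => .inr (.inr false)
  invFun
    | .inl (.inl i) => .a i
    | .inl (.inr i) => .b i
    | .inr (.inl i) => .c i
    | .inr (.inr true) => .x
    | .inr (.inr false) => .y
  left_inv v := by cases v <;> rfl
  right_inv v := by rcases v with (i | i) | (i | (_ | _)) <;> rfl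

instance (k : ℕ) : Fintype (Vert k) := Fintype.ofEquiv _ (vertEquiv k).symm

theorem card_vert {k : ℕ} (hk : 1 ≤ k) : Nat.card (Vert k) = 3 * k + 1 := by
  rw [Nat.card_congr (vertEquiv k)]
  simp
  omega

theorem sum_vert {k : ℕ} (f : Vert k → ℕ) : ∑ v, f v =
    ∑ i ∈ Finset.range k, f (av k i) + ∑ i ∈ Finset.range k, f (bv k i) +
      ∑ i ∈ Finset.range (k - 1), f (cv k i) + f .x + f .y := by
  rw [← (vertEquiv k).symm.sum_comp, Fintype.sum_sum_type, Fintype.sum_sum_type,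
    Fintype.sum_sum_type, Fintype.sum_bool, ← Fin.sum_univ_eq_sum_range (fun i => f (av k i)),
    ← Fin.sum_univ_eq_sum_range (fun i => f (bv k i)),
    ← Fin.sum_univ_eq_sum_range (fun i => f (cv k i))]
  simp [vertEquiv, av_eq, bv_eq, cv_eq, add_assoc]

/-- The number of edges of a subgraph of `H_k`. -/
theorem card_edges {k : ℕ} (hk : 4 ≤ k) {T : SimpleGraph (Vert k)} (hT : T ≤ graphH hk) :
    Nat.card T.edgeSet =
      ∑ i ∈ Finset.range (k - 1), blockSize (eAA T i) (eAC T i) (eCA T i) (eBB T i) (eBC T i)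
          (eCB T i) + (adjB T .x .y).toNat + (adjB T .x (av k 0)).toNat +
        (adjB T .x (av k (k - 1))).toNat + (adjB T .y (bv k 0)).toNat +
        (adjB T .y (bv k (k - 1))).toNat + (adjB T (av k 0) (av k (k - 1))).toNat := by
  classical
  have h := T.sum_degrees_eq_twice_card_edges
  have hd : ∀ v, T.degree v = deg T v := fun v => by
    rw [deg, ← Nat.card_coe_set_eq, Nat.card_eq_fintype_card, SimpleGraph.card_neighborSet_eq_degree]
  have hE : T.edgeFinset.card = Nat.card T.edgeSet := by
    rw [Nat.card_eq_fintype_card, SimpleGraph.edgeFinset_card]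
  rw [hE] at h
  simp only [hd] at h
  rw [sum_vert] at h
  have hA := deg_a_last hk hT
  have hB := deg_b_last hk hT
  have hAm := fun i hi => deg_a_mid hk hT (i := i) hi
  have hBm := fun i hi => deg_b_mid hk hT (i := i) hi
  have hC := fun i hi => deg_c hk hT (i := i) hi
  rw [deg_x hk hT, deg_y hk hT] at h
  obtain ⟨n, rfl⟩ : ∃ n, k = n + 1 := ⟨k - 1, by omega⟩
  simp only [Nat.add_sub_cancel] at *
  rw [Finset.sum_range_succ, Finset.sum_range_succ, hA, hB,
    Finset.sum_congr rfl fun i hi => hAm i (Finset.mem_range.1 hi),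
    Finset.sum_congr rfl fun i hi => hBm i (Finset.mem_range.1 hi),
    Finset.sum_congr rfl fun i hi => hC i (Finset.mem_range.1 hi), Finset.sum_add_distrib,
    Finset.sum_add_distrib] at h
  -- Handshake count: shifting the sum of the left degrees by one turns it into the sum of the edges
  -- leading right from each block, plus the outer edges at the first rung. Every edge is then
  -- counted twice.
  have eA := (Finset.sum_range_succ (leftA T) n).symm.trans (Finset.sum_range_succ' _ _)
  have eB := (Finset.sum_range_succ (leftB T) n).symm.trans (Finset.sum_range_succ' _ _)
  have eA' : ∑ i ∈ Finset.range n, leftA T (i + 1) =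
      ∑ i ∈ Finset.range n, (eAA T i).toNat + ∑ i ∈ Finset.range n, (eCA T i).toNat :=
    Finset.sum_add_distrib
  have eB' : ∑ i ∈ Finset.range n, leftB T (i + 1) =
      ∑ i ∈ Finset.range n, (eBB T i).toNat + ∑ i ∈ Finset.range n, (eCB T i).toNat :=
    Finset.sum_add_distrib
  have a0 : leftA T 0 = (adjB T .x (av (n + 1) 0)).toNat +
    (adjB T (av (n + 1) 0) (av (n + 1) n)).toNat := rfl
  have b0 : leftB T 0 = (adjB T .y (bv (n + 1) 0)).toNat := rfl
  simp only [Finset.sum_add_distrib, blockSize] at *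
  omega

/-! ### Links in the left part and the cycles they forbid -/

/-- The vertices of the ladder up to the `i`-th rung. -/
def InLeft {k : ℕ} (i : ℕ) : Vert k → Prop
  | .a j => (j : ℕ) ≤ i
  | .b j => (j : ℕ) ≤ i
  | .c j => (j : ℕ) < i
  | .x => False
  | .y => False

theorem InLeft.succ {k i : ℕ} {v : Vert k} (h : InLeft i v) : InLeft (i + 1) v := by
  cases v <;> simp only [InLeft] at h ⊢ <;> omega

/-- The subgraph of `T` induced on the ladder up to the `i`-th rung. -/
def leftPart {k : ℕ} (T : SimpleGraph (Vert k)) (i : ℕ) : SimpleGraph (Vert k) where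
  Adj u v := T.Adj u v ∧ InLeft i u ∧ InLeft i v
  symm := ⟨fun _ _ h => ⟨h.1.symm, h.2.2, h.2.1⟩⟩
  loopless := ⟨fun _ h => h.1.ne rfl⟩

theorem leftPart_mono {k : ℕ} (T : SimpleGraph (Vert k)) (i : ℕ) :
    leftPart T i ≤ leftPart T (i + 1) := fun _ _ h => ⟨h.1, h.2.1.succ, h.2.2.succ⟩

/-- A sufficient condition for `aᵢ` and `bᵢ` being linked in `leftPart T i`. -/
noncomputable def linked {k : ℕ} (T : SimpleGraph (Vert k)) : ℕ → Bool
  | 0 => false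
  | i + 1 => nextLink (linked T i) (eAA T i) (eAC T i) (eCA T i) (eBB T i) (eBC T i) (eCB T i)

theorem component_eq {V : Type*} {G : SimpleGraph V} {u v : V} (h : G.Adj u v) :
    G.connectedComponentMk u = G.connectedComponentMk v :=
  SimpleGraph.ConnectedComponent.sound h.reachable

/-- Each disjunct of `nextLink` spells out a walk between the new rail vertices through the block,
possibly using the old link. Only this direction is needed: `linked` is never required to detect
every connection. -/
theorem reachable_of_linked {k : ℕ} (T : SimpleGraph (Vert k)) (i : ℕ) (hi : i < k)
    (h : linked T i = true) : (leftPart T i).Reachable (av k i) (bv k i) := by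
  induction i with
  | zero => simp [linked] at h
  | succ i ih =>
    have ih := fun h => SimpleGraph.ConnectedComponent.sound
      ((ih (by omega) h).mono (leftPart_mono T i))
    apply SimpleGraph.ConnectedComponent.exact
    have la : InLeft (i + 1) (av k i) := by rw [av_eq (by omega)]; simp [InLeft]
    have lb : InLeft (i + 1) (bv k i) := by rw [bv_eq (by omega)]; simp [InLeft]
    have lc : InLeft (i + 1) (cv k i) := by rw [cv_eq (by omega)]; simp [InLeft]
    have la' : InLeft (i + 1) (av k (i + 1)) := by rw [av_eq (by omega)]; simp [InLeft]
    have lb' : InLeft (i + 1) (bv k (i + 1)) := by rw [bv_eq (by omega)]; simp [InLeft]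
    have adj : ∀ {u v}, InLeft (i + 1) u → InLeft (i + 1) v → adjB T u v = true →
        (leftPart T (i + 1)).connectedComponentMk u =
          (leftPart T (i + 1)).connectedComponentMk v :=
      fun hu hv h => component_eq ⟨adjB_iff.1 h, hu, hv⟩
    have h₁ := adj la la'
    have h₂ := adj la lc
    have h₃ := adj la' lc
    have h₄ := adj lb lb'
    have h₅ := adj lb lc
    have h₆ := adj lb' lc
    simp only [linked, nextLink, eAA, eAC, eCA, eBB, eBC, eCB, Bool.or_eq_true,
      Bool.and_eq_true] at h
    grind

theorem component_ne_of_isAcyclic {V : Type*} {T : SimpleGraph V} (hT : T.IsAcyclic) {u v : V}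
    (h : T.Adj u v) : (T.deleteEdges {s(u, v)}).connectedComponentMk u ≠
      (T.deleteEdges {s(u, v)}).connectedComponentMk v := by
  intro h'
  have := SimpleGraph.isAcyclic_iff_forall_adj_isBridge.1 hT h
  rw [SimpleGraph.isBridge_iff] at this
  exact this (SimpleGraph.ConnectedComponent.exact h')

theorem component_deleteEdges_eq {V : Type*} {T : SimpleGraph V} {u v p q : V} (h : T.Adj p q)
    (hne : s(p, q) ≠ s(u, v)) : (T.deleteEdges {s(u, v)}).connectedComponentMk p =
      (T.deleteEdges {s(u, v)}).connectedComponentMk q :=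
  component_eq (by simpa [SimpleGraph.deleteEdges_adj, h] using hne)

theorem not_triangle {V : Type*} {T : SimpleGraph V} (hT : T.IsAcyclic) {u v w : V}
    (h₁ : T.Adj u v) (h₂ : T.Adj u w) (h₃ : T.Adj v w) : False := by
  refine component_ne_of_isAcyclic hT h₁ ((component_deleteEdges_eq h₂ ?_).trans
    (component_deleteEdges_eq h₃.symm ?_))
  · have := h₃.ne; have := h₁.ne; have := h₂.ne
    simp; tauto
  · have := h₃.ne; have := h₁.ne; have := h₂.ne
    simp; tauto

/-- The left part joins the two rail vertices without touching `cv k i`, and the block joins each of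
them to `cv k i`, which closes a cycle. It is detected by an edge at `cv k i` on the `b` side not
being a bridge. -/
theorem not_linked_cycle {k : ℕ} {T : SimpleGraph (Vert k)} (hT : T.IsAcyclic) {i : ℕ}
    (hi : i < k - 1) (hl : linked T i = true) (ha : eAC T i = true ∨ eAA T i = true ∧ eCA T i = true)
    (hb : eBC T i = true ∨ eBB T i = true ∧ eCB T i = true) : False := by
  have hl := reachable_of_linked T i (by omega) hl
  have key : ∀ u, T.Adj u (cv k i) → (u = bv k i ∨ u = bv k (i + 1)) →
      (T.deleteEdges {s(u, cv k i)}).connectedComponentMk (bv k i) =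
        (T.deleteEdges {s(u, cv k i)}).connectedComponentMk (cv k i) := by
    intro u hu hu'
    have hle : leftPart T i ≤ T.deleteEdges {s(u, cv k i)} := by
      intro p q hpq
      simp only [SimpleGraph.deleteEdges_adj, hpq.1, true_and, Set.mem_singleton_iff]
      have hc : ¬ InLeft i (cv k i) := by rw [cv_eq hi]; simp [InLeft]
      intro h
      rcases Sym2.eq_iff.1 h with ⟨_, rfl⟩ | ⟨rfl, _⟩
      · exact hc hpq.2.2
      · exact hc hpq.2.1
    have hab := SimpleGraph.ConnectedComponent.sound (hl.mono hle)
    have adj : ∀ {p q}, adjB T p q = true → s(p, q) ≠ s(u, cv k i) →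
        (T.deleteEdges {s(u, cv k i)}).connectedComponentMk p =
          (T.deleteEdges {s(u, cv k i)}).connectedComponentMk q :=
      fun h => component_deleteEdges_eq (adjB_iff.1 h)
    rcases ha with ha | ⟨ha, ha'⟩
    · rw [← hab]
      apply adj ha
      rcases hu' with rfl | rfl
      · rw [av_eq (by omega), bv_eq (by omega), cv_eq hi]; simp
      · rw [av_eq (by omega), bv_eq (by omega), cv_eq hi]; simp
    · rw [← hab]
      refine (adj ha ?_).trans (adj ha' ?_)
      · rcases hu' with rfl | rfl
        · rw [av_eq (by omega), av_eq (by omega), bv_eq (by omega), cv_eq hi]; simp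
        · rw [av_eq (by omega), av_eq (by omega), bv_eq (by omega), cv_eq hi]; simp
      · rcases hu' with rfl | rfl
        · rw [av_eq (by omega), bv_eq (by omega), cv_eq hi]; simp
        · rw [av_eq (by omega), bv_eq (by omega), cv_eq hi]; simp
  rcases hb with hb | ⟨hb, hb'⟩
  · exact component_ne_of_isAcyclic hT (adjB_iff.1 hb) (key _ (adjB_iff.1 hb) (.inl rfl))
  · refine component_ne_of_isAcyclic hT (adjB_iff.1 hb')
      (.trans ?_ (key _ (adjB_iff.1 hb') (.inr rfl)))
    refine (component_deleteEdges_eq (adjB_iff.1 hb) ?_).symm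
    rw [bv_eq (by omega), bv_eq (by omega), cv_eq hi]; simp

/-! ### No HIST in `H_k` -/

theorem okDeg_of_ne {d : ℕ} (h : d ≤ 4) (h₀ : d ≠ 0) (h₂ : d ≠ 2) : okDeg d = true := by
  interval_cases d <;> simp_all [okDeg]

theorem deg_ne_zero {V : Type*} [Finite V] [Nontrivial V] {T : SimpleGraph V} (hT : T.Connected)
    (v : V) : deg T v ≠ 0 := by
  obtain ⟨w, hw⟩ := hT.preconnected.exists_adj_of_nontrivial v
  have : (T.neighborSet v).Nonempty := ⟨w, hw⟩
  exact (this.ncard_pos (Set.toFinite _)).ne'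

theorem not_hasHIST_graphH {k : ℕ} (hk : 4 ≤ k) (hev : Even k) : ¬ HasHIST (graphH hk) := by
  rintro ⟨T, hT, htree, hdeg⟩
  have hac := htree.isAcyclic
  have : Nontrivial (Vert k) := ⟨.x, .y, by simp⟩
  have h0 := deg_ne_zero htree.connected
  have hle : ∀ b : Bool, b.toNat ≤ 1 := Bool.toNat_le
  have hlA : ∀ i, leftA T i ≤ 2 := by
    rintro (_ | i)
    · have := hle (adjB T .x (av k 0)); have := hle (adjB T (av k 0) (av k (k - 1)))
      simp only [leftA]; omega
    · have := hle (eAA T i); have := hle (eCA T i)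
      simp only [leftA]; omega
  have hlB : ∀ i, leftB T i ≤ 2 := by
    rintro (_ | i)
    · have := hle (adjB T .y (bv k 0))
      simp only [leftB]; omega
    · have := hle (eBB T i); have := hle (eCB T i)
      simp only [leftB]; omega
  have hblock : ∀ i < k - 1, blockOk (leftA T i) (leftB T i) (linked T i) (eAA T i) (eAC T i)
      (eCA T i) (eBB T i) (eBC T i) (eCB T i) = true := by
    intro i hi
    have dc := deg_c hk hT hi
    have da := deg_a_mid hk hT hi
    have db := deg_b_mid hk hT hi
    have := hle (eAA T i); have := hle (eAC T i); have := hle (eCA T i)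
    have := hle (eBB T i); have := hle (eBC T i); have := hle (eCB T i)
    have := hlA i; have := hlB i
    simp only [blockOk, Bool.and_eq_true, Bool.not_eq_true', Bool.eq_false_iff, ne_eq,
      Bool.or_eq_true, add_assoc]
    refine ⟨⟨⟨⟨⟨okDeg_of_ne (by omega) ?_ ?_, okDeg_of_ne (by omega) ?_ ?_⟩,
      okDeg_of_ne (by omega) ?_ ?_⟩, ?_⟩, ?_⟩, ?_⟩
    · have := h0 (cv k i); omega
    · have := hdeg (cv k i); omega
    · have := h0 (av k i); omega
    · have := hdeg (av k i); omega
    · have := h0 (bv k i); omega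
    · have := hdeg (bv k i); omega
    · rintro ⟨⟨h₁, h₂⟩, h₃⟩
      exact not_triangle hac (adjB_iff.1 h₁) (adjB_iff.1 h₂) (adjB_iff.1 h₃)
    · rintro ⟨⟨h₁, h₂⟩, h₃⟩
      exact not_triangle hac (adjB_iff.1 h₁) (adjB_iff.1 h₂) (adjB_iff.1 h₃)
    · rintro ⟨⟨h₁, h₂⟩, h₃⟩
      exact not_linked_cycle hac hi h₁ h₂ h₃
  have hbound := ladder_bound (leftA T 0) (leftB T 0) (hlA 0) (hle _) (eAA T) (eAC T) (eCA T)
    (eBB T) (eBC T) (eCB T) (leftA T) (leftB T) (linked T) rfl rfl rfl (fun _ => rfl)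
    (fun _ => rfl) (fun _ => rfl) (k - 1) hblock (k - 2) (by omega)
  -- The only use of the evenness of `k`: it selects the parity for which `potential_end` holds.
  have hp : decide ((k - 2) % 2 = 0) = true := by
    obtain ⟨m, rfl⟩ := hev
    simp; omega
  rw [hp, show k - 2 + 1 = k - 1 by omega] at hbound
  have hcard := card_edges hk hT
  have htot := (SimpleGraph.isTree_iff_connected_and_card.1 htree).2
  rw [card_vert (by omega)] at htot
  have hend := potential_end ⟨leftA T (k - 1), by have := hlA (k - 1); omega⟩
    ⟨leftB T (k - 1), by have := hlB (k - 1); omega⟩ (linked T (k - 1)) (adjB T .x .y)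
    (adjB T .x (av k 0)) (adjB T .x (av k (k - 1))) (adjB T .y (bv k 0)) (adjB T .y (bv k (k - 1)))
    (adjB T (av k 0) (av k (k - 1)))
    (by
      intro h
      obtain ⟨n, hn⟩ : ∃ n, k - 1 = n + 1 := ⟨k - 2, by omega⟩
      simp only [hn] at h ⊢
      exact pos_of_nextLink _ _ _ _ _ _ _ h)
    (by
      have da := deg_a_last hk hT
      have db := deg_b_last hk hT
      have dx := deg_x hk hT
      have dy := deg_y hk hT
      have := hle (adjB T .x .y); have := hle (adjB T .x (av k 0))
      have := hle (adjB T .x (av k (k - 1))); have := hle (adjB T .y (bv k 0))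
      have := hle (adjB T .y (bv k (k - 1))); have := hle (adjB T (av k 0) (av k (k - 1)))
      have := hlA (k - 1); have := hlB (k - 1)
      simp only [endOk, Bool.and_eq_true, Bool.not_eq_true', Bool.eq_false_iff, ne_eq]
      refine ⟨⟨⟨⟨okDeg_of_ne (by omega) ?_ ?_, okDeg_of_ne (by omega) ?_ ?_⟩,
        okDeg_of_ne (by omega) ?_ ?_⟩, okDeg_of_ne (by omega) ?_ ?_⟩, ?_⟩
      · have := h0 .x; omega
      · have := hdeg .x; omega
      · have := h0 .y; omega
      · have := hdeg .y; omega
      · have := h0 (av k (k - 1)); omega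
      · have := hdeg (av k (k - 1)); omega
      · have := h0 (bv k (k - 1)); omega
      · have := hdeg (bv k (k - 1)); omega
      · rintro ⟨⟨h₁, h₂⟩, h₃⟩
        exact not_triangle hac (adjB_iff.1 h₁) (adjB_iff.1 h₂) (adjB_iff.1 h₃))
  simp only [leftA, leftB] at hbound hend
  -- The tree has `3k` edges, in blocks or outside. The blocks contain at most `3k - 1` plus the
  -- link correction minus the potential, and the outer edges plus that correction are at most the
  -- potential, so the total is at most `3k - 1`.
  omega

/-! ### Degrees in `G_k` and `H_k` -/

theorem graphG_le_graphH {k : ℕ} (hk : 4 ≤ k) : graphG k ≤ graphH hk := le_sup_left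

/-- The degrees in a graph between `G_k` and `H_k`. -/
theorem deg_eq_four_iff {k : ℕ} (hk : 4 ≤ k) {T : SimpleGraph (Vert k)} (hG : graphG k ≤ T)
    (hT : T ≤ graphH hk) (v : Vert k) : deg T v ≠ 4 ↔
      v = bFirst hk ∨ v = bLast hk ∨ v = .x ∨ v = .y ∨
        ((v = aFirst hk ∨ v = aLast hk) ∧ ¬ T.Adj (aFirst hk) (aLast hk)) := by
  have adj : ∀ {u v}, edgeRel k u v → adjB T u v = true := fun h =>
    adjB_iff.2 (hG (graphG_adj.2 (.inl h)))
  have adj' : ∀ {u v}, edgeRel k v u → adjB T u v = true := fun h =>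
    adjB_iff.2 (hG (graphG_adj.2 (.inr h)))
  have hAA : ∀ i < k - 1, eAA T i = true := fun i hi =>
    adj (by rw [av_eq (by omega), av_eq (by omega)]; simp [edgeRel])
  have hAC : ∀ i < k - 1, eAC T i = true := fun i hi =>
    adj (by rw [av_eq (by omega), cv_eq (by omega)]; simp [edgeRel])
  have hCA : ∀ i < k - 1, eCA T i = true := fun i hi =>
    adj (by rw [av_eq (by omega), cv_eq (by omega)]; simp [edgeRel])
  have hBB : ∀ i < k - 1, eBB T i = true := fun i hi =>
    adj (by rw [bv_eq (by omega), bv_eq (by omega)]; simp [edgeRel])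
  have hBC : ∀ i < k - 1, eBC T i = true := fun i hi =>
    adj (by rw [bv_eq (by omega), cv_eq (by omega)]; simp [edgeRel])
  have hCB : ∀ i < k - 1, eCB T i = true := fun i hi =>
    adj (by rw [bv_eq (by omega), cv_eq (by omega)]; simp [edgeRel])
  have hx₁ : adjB T .x (av k 0) = true := adj' (by rw [av_eq (by omega)]; simp [edgeRel])
  have hx₂ : adjB T .x (av k (k - 1)) = true :=
    adj' (by rw [av_eq (by omega)]; simp [edgeRel]; omega)
  have hy₁ : adjB T .y (bv k 0) = true := adj' (by rw [bv_eq (by omega)]; simp [edgeRel])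
  have hy₂ : adjB T .y (bv k (k - 1)) = true :=
    adj' (by rw [bv_eq (by omega)]; simp [edgeRel]; omega)
  have hxy : adjB T .x .y = true := adj (by simp [edgeRel])
  have h0 : aFirst hk = av k 0 := (av_eq (by omega)).symm
  have h1 : aLast hk = av k (k - 1) := (av_eq (by omega)).symm
  obtain ⟨n, hn⟩ : ∃ n, k - 1 = n + 1 := ⟨k - 2, by omega⟩
  have last : deg T (aLast hk) = 3 + (adjB T (av k 0) (av k (k - 1))).toNat := by
    rw [h1, deg_a_last hk hT, hx₂, hn, leftA, hAA n (by omega), hCA n (by omega)]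
    simp; omega
  have lastB : deg T (bLast hk) = 3 := by
    rw [show bLast hk = bv k (k - 1) from (bv_eq (by omega)).symm, deg_b_last hk hT, hy₂, hn, leftB,
      hBB n (by omega), hCB n (by omega)]
    simp
  have hadj : T.Adj (aFirst hk) (aLast hk) ↔ (adjB T (av k 0) (av k (k - 1))).toNat = 1 := by
    rw [h0, h1, ← adjB_iff, Bool.toNat_eq_one]
  rw [hadj]
  obtain ⟨B, hB'⟩ : ∃ B, adjB T (av k 0) (av k (k - 1)) = B := ⟨_, rfl⟩
  rw [hB'] at last ⊢
  rcases v with i | i | i | _ | _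
  · rcases eq_or_ne (Vert.a i) (aLast hk) with h | h
    · rw [h, last]
      cases B <;> simp [bFirst, bLast, aLast]
    · have hi : (i : ℕ) < k - 1 := by
        have : (i : ℕ) ≠ k - 1 := fun h' => h (by simp [aLast, Fin.ext_iff, h'])
        have := i.2
        omega
      have hd := deg_a_mid hk hT hi
      rw [av_eq i.2, hAA _ hi, hAC _ hi] at hd
      rw [hd]
      simp only [h, or_false, bFirst, bLast, reduceCtorEq, false_or]
      rcases i with ⟨_ | i, hi'⟩
      · cases B <;> simp [leftA, hx₁, hB', aFirst]
      · have hi : i + 1 < k - 1 := hi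
        simp [leftA, aFirst, hAA i (by omega), hCA i (by omega)]
  · rcases eq_or_ne (Vert.b i) (bLast hk) with h | h
    · simp [h, lastB]
    · have hi : (i : ℕ) < k - 1 := by
        have : (i : ℕ) ≠ k - 1 := fun h' => h (by simp [bLast, Fin.ext_iff, h'])
        have := i.2
        omega
      have hd := deg_b_mid hk hT hi
      rw [bv_eq i.2, hBB _ hi, hBC _ hi] at hd
      rw [hd]
      simp only [h, aFirst, aLast, reduceCtorEq, or_false, false_and]
      rcases i with ⟨_ | i, hi'⟩
      · simp [leftB, hy₁, bFirst]
      · have hi : i + 1 < k - 1 := hi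
        simp [leftB, bFirst, hBB i (by omega), hCB i (by omega)]
  · have hd := deg_c hk hT i.2
    rw [cv_eq i.2, hAC _ i.2, hCA _ i.2, hBC _ i.2, hCB _ i.2] at hd
    rw [hd]
    simp [aFirst, aLast, bFirst, bLast]
  · rw [deg_x hk hT, hxy, hx₁, hx₂]
    simp
  · rw [deg_y hk hT, hxy, hy₁, hy₂]
    simp

theorem deg_graphG_ne_four {k : ℕ} (hk : 4 ≤ k) : {v | deg (graphG k) v ≠ 4} =
    {aFirst hk, aLast hk, bFirst hk, bLast hk, .x, .y} := by
  have h : ¬ (graphG k).Adj (aFirst hk) (aLast hk) := by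
    rw [graphG_adj]; simp [edgeRel, aFirst, aLast]; omega
  ext v
  simp only [Set.mem_ofPred_eq, deg_eq_four_iff hk le_rfl (graphG_le_graphH hk), h,
    Set.mem_insert_iff, Set.mem_singleton_iff]
  tauto

theorem deg_graphH_ne_four {k : ℕ} (hk : 4 ≤ k) : {v | deg (graphH hk) v ≠ 4} =
    {bFirst hk, bLast hk, .x, .y} := by
  have h : (graphH hk).Adj (aFirst hk) (aLast hk) := (graphH_adj hk).2 (by simp)
  ext v
  simp only [Set.mem_ofPred_eq, deg_eq_four_iff hk (graphG_le_graphH hk) le_rfl, h,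
    Set.mem_insert_iff, Set.mem_singleton_iff]
  tauto

theorem deleteEdges_graphH {k : ℕ} (hk : 4 ≤ k) :
    (graphH hk).deleteEdges {s(aFirst hk, aLast hk)} = graphG k := by
  have h : ¬ (graphG k).Adj (aFirst hk) (aLast hk) := by
    rw [graphG_adj]; simp [edgeRel, aFirst, aLast]; omega
  ext u v
  simp only [SimpleGraph.deleteEdges_adj, graphH, SimpleGraph.sup_adj, SimpleGraph.edge_adj,
    Set.mem_singleton_iff, Sym2.eq_iff]
  constructor
  · tauto
  · refine fun h' => ⟨.inl h', ?_⟩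
    rintro (⟨rfl, rfl⟩ | ⟨rfl, rfl⟩)
    · exact h h'
    · exact h h'.symm

/-! ### HISTs of the vertex-deleted subgraphs -/

/-- A rooted tree described by a parent function is a HIST if every vertex has no child (and is
not the root), or at least two children (three for the root). -/
theorem hasHIST_of_parent {V : Type*} [Finite V] (G : SimpleGraph V) (r : V) (P : V → V)
    (rank : V → ℕ) (h : ∀ v, v ≠ r → G.Adj v (P v) ∧ rank (P v) < rank v)
    (hdeg : ∀ v, (v ≠ r ∧ ∀ w, w ≠ r → P w ≠ v) ∨
      (∃ w₁ w₂, w₁ ≠ r ∧ w₂ ≠ r ∧ w₁ ≠ w₂ ∧ P w₁ = v ∧ P w₂ = v ∧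
        (v = r → ∃ w₃, w₃ ≠ r ∧ w₃ ≠ w₁ ∧ w₃ ≠ w₂ ∧ P w₃ = v))) : HasHIST G := by
  let T : SimpleGraph V := SimpleGraph.fromRel fun u v => u ≠ r ∧ P u = v
  have hP : ∀ v, v ≠ r → T.Adj v (P v) := fun v hv =>
    (SimpleGraph.fromRel_adj _ _ _).2 ⟨(h v hv).1.ne, .inl ⟨hv, rfl⟩⟩
  have hreach : ∀ n v, rank v = n → T.Reachable v r := by
    intro n
    induction n using Nat.strong_induction_on with
    | _ n ih =>
      rintro v rfl
      by_cases hv : v = r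
      · rw [hv]
      · exact (hP v hv).reachable.trans (ih _ (h v hv).2 _ rfl)
  have hconn : T.Connected :=
    { preconnected := fun u v => (hreach _ u rfl).trans (hreach _ v rfl).symm
      nonempty := ⟨r⟩ }
  refine ⟨T, ?_, SimpleGraph.isTree_iff_connected_and_card.2 ⟨hconn, ?_⟩, ?_⟩
  · intro u v huv
    obtain ⟨-, ⟨hu, rfl⟩ | ⟨hv, rfl⟩⟩ := (SimpleGraph.fromRel_adj _ _ _).1 huv
    · exact (h u hu).1
    · exact (h v hv).1.symm
  -- Every edge joins a non-root vertex to its parent, so there are at most as many edges as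
  -- non-root vertices; connectedness gives the other inequality.
  · have h₁ := hconn.card_vert_le_card_edgeSet_add_one
    have h₂ : Nat.card T.edgeSet ≤ Nat.card {v : V // v ≠ r} := by
      refine Nat.card_le_card_of_surjective
        (fun v : {v : V // v ≠ r} => (⟨s(v.1, P v.1), hP v.1 v.2⟩ : T.edgeSet)) ?_
      rintro ⟨e, he⟩
      induction e with
      | _ u v =>
        obtain ⟨-, ⟨hu, rfl⟩ | ⟨hv, rfl⟩⟩ := (SimpleGraph.fromRel_adj _ _ _).1
          (show T.Adj u v from he)
        · exact ⟨⟨u, hu⟩, rfl⟩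
        · exact ⟨⟨v, hv⟩, Subtype.ext Sym2.eq_swap⟩
    have h₃ : Nat.card {v : V // v ≠ r} + 1 = Nat.card V := by
      have : Nat.card ({v : V | v ≠ r} : Set V) = _ := Nat.card_coe_set_eq _
      have h' := Set.ncard_add_ncard_compl ({r} : Set V)
      rw [Set.ncard_singleton] at h'
      have h'' : {v : V | v ≠ r} = ({r} : Set V)ᶜ := rfl
      rw [h''] at this
      change Nat.card (({r} : Set V)ᶜ : Set V) + 1 = _
      omega
    omega
  · intro v
    rcases hdeg v with ⟨hv, hl⟩ | ⟨w₁, w₂, h₁, h₂, h₁₂, hw₁, hw₂, h₃⟩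
    · have : T.neighborSet v = {P v} := by
        ext w
        simp only [SimpleGraph.mem_neighborSet, Set.mem_singleton_iff]
        constructor
        · intro hw
          obtain ⟨-, ⟨-, h'⟩ | ⟨hu, h'⟩⟩ := (SimpleGraph.fromRel_adj _ _ _).1 hw
          · exact h'.symm
          · exact absurd h' (hl w hu)
        · rintro rfl
          exact hP v hv
      rw [deg, this, Set.ncard_singleton]
      decide
    · have key : ∀ w₃, T.Adj v w₃ → w₃ ≠ w₁ → w₃ ≠ w₂ → deg T v ≠ 2 := by
        intro w₃ hw₃ h₃₁ h₃₂
        have hsub : ({w₁, w₂, w₃} : Set V) ⊆ T.neighborSet v := by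
          rintro w (rfl | rfl | rfl)
          · rw [← hw₁]; exact (hP _ h₁).symm
          · rw [← hw₂]; exact (hP _ h₂).symm
          · exact hw₃
        have := Set.ncard_le_ncard hsub (Set.toFinite _)
        rw [Set.ncard_eq_three.2 ⟨w₁, w₂, w₃, h₁₂, h₃₁.symm, h₃₂.symm, rfl⟩] at this
        rw [deg]
        omega
      by_cases hv : v = r
      · obtain ⟨w₃, h₃r, h₃₁, h₃₂, hw₃⟩ := h₃ hv
        exact key w₃ (by rw [← hw₃]; exact (hP _ h₃r).symm) h₃₁ h₃₂
      -- The parent has smaller rank and the children have larger rank, so the parent is a third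
      -- neighbour.
      · have r₁ := (h w₁ h₁).2
        have r₂ := (h w₂ h₂).2
        have r₃ := (h v hv).2
        rw [hw₁] at r₁
        rw [hw₂] at r₂
        refine key (P v) (hP v hv) ?_ ?_
        · intro h'
          rw [h'] at r₃
          omega
        · intro h'
          rw [h'] at r₃
          omega

theorem HasHIST.iso {V W : Type*} {G : SimpleGraph V} {G' : SimpleGraph W} (φ : G ≃g G')
    (h : HasHIST G) : HasHIST G' := by
  obtain ⟨T, hT, htree, hdeg⟩ := h
  refine ⟨T.comap φ.symm, fun u v huv => φ.symm.map_adj_iff.1 (hT huv),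
    (SimpleGraph.Iso.comap φ.symm.toEquiv T).isTree_iff.2 htree, fun v => ?_⟩
  have : T.neighborSet (φ.symm v) = φ.symm '' (T.comap φ.symm).neighborSet v := by
    ext w
    simp only [SimpleGraph.mem_neighborSet, Set.mem_image, SimpleGraph.comap_adj]
    constructor
    · intro hw
      exact ⟨φ w, by simpa using hw, by simp⟩
    · rintro ⟨u, hu, rfl⟩
      exact hu
  have h' := hdeg (φ.symm v)
  rwa [deg, this, Set.ncard_image_of_injective _ φ.symm.injective] at h'

theorem HasHIST.deleteVertex_iso {V W : Type*} {G : SimpleGraph V} {G' : SimpleGraph W}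
    (φ : G ≃g G') {v : V} (h : HasHIST (deleteVertex G v)) :
    HasHIST (deleteVertex G' (φ v)) :=
  h.iso (show deleteVertex G v ≃g deleteVertex G' (φ v) from
    ⟨φ.toEquiv.subtypeEquiv fun w => (by simp), fun {a b} => φ.map_adj_iff (v := a.1) (w := b.1)⟩)

theorem HasHIST.mono {V : Type*} {G G' : SimpleGraph V} (hle : G ≤ G') (h : HasHIST G) :
    HasHIST G' := by
  obtain ⟨T, hT, h'⟩ := h
  exact ⟨T, hT.trans hle, h'⟩

theorem IsK1Histonian.mono {V : Type*} {G G' : SimpleGraph V} (hle : G ≤ G')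
    (h : IsK1Histonian G) : IsK1Histonian G' :=
  fun v => (h v).mono fun _ _ huv => hle huv

/-- The reflection of `G_k` that reverses the indices. -/
def revIso (k : ℕ) : graphG k ≃g graphG k where
  toFun
    | .a i => .a i.rev
    | .b i => .b i.rev
    | .c i => .c i.rev
    | .x => .x
    | .y => .y
  invFun
    | .a i => .a i.rev
    | .b i => .b i.rev
    | .c i => .c i.rev
    | .x => .x
    | .y => .y
  left_inv v := by cases v <;> simp
  right_inv v := by cases v <;> simp
  map_rel_iff' {u v} := by
    rw [graphG_adj, graphG_adj]
    cases u <;> cases v <;> simp [edgeRel, Fin.val_rev] <;> omega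

/-- The reflection of `G_k` that exchanges the two rails. -/
def swapIso (k : ℕ) : graphG k ≃g graphG k where
  toFun
    | .a i => .b i
    | .b i => .a i
    | .c i => .c i
    | .x => .y
    | .y => .x
  invFun
    | .a i => .b i
    | .b i => .a i
    | .c i => .c i
    | .x => .y
    | .y => .x
  left_inv v := by cases v <;> simp
  right_inv v := by cases v <;> simp
  map_rel_iff' {u v} := by
    rw [graphG_adj, graphG_adj]
    cases u <;> cases v <;> simp [edgeRel]

/-- The vertices of all graphs `G_k`, with natural number indices. -/
inductive NVert : Type
  | a (i : ℕ)
  | b (i : ℕ)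
  | c (i : ℕ)
  | x
  | y

/-- The inclusion of the vertices of `G_k`. -/
def toN {k : ℕ} : Vert k → NVert
  | .a i => .a i
  | .b i => .b i
  | .c i => .c i
  | .x => .x
  | .y => .y

theorem toN_injective (k : ℕ) : Function.Injective (toN (k := k)) := by
  intro u v h
  cases u <;> cases v <;> simp [toN, Fin.ext_iff] at h ⊢ <;> exact h

/-- Being a vertex of `G_k`. -/
def NVert.Valid (k : ℕ) : NVert → Prop
  | .a i => i < k
  | .b i => i < k
  | .c i => i + 1 < k
  | .x => True
  | .y => True

theorem NVert.Valid.exists_toN {k : ℕ} {u : NVert} (h : u.Valid k) : ∃ v : Vert k, toN v = u := by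
  cases u with
  | a i => exact ⟨.a ⟨i, h⟩, rfl⟩
  | b i => exact ⟨.b ⟨i, h⟩, rfl⟩
  | c i => exact ⟨.c ⟨i, by have : i + 1 < k := h; omega⟩, rfl⟩
  | x => exact ⟨.x, rfl⟩
  | y => exact ⟨.y, rfl⟩

theorem toN_valid {k : ℕ} (v : Vert k) : (toN v).Valid k := by
  cases v <;> simp only [toN, NVert.Valid] <;> omega

/-- The edges of `G_k` in terms of natural number indices. -/
def NVert.Edge (k : ℕ) : NVert → NVert → Prop
  | .a i, .a j => j = i + 1
  | .b i, .b j => j = i + 1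
  | .a i, .c j => i = j ∨ i = j + 1
  | .b i, .c j => i = j ∨ i = j + 1
  | .a i, .x => i = 0 ∨ i + 1 = k
  | .b i, .y => i = 0 ∨ i + 1 = k
  | .x, .y => True
  | _, _ => False

theorem edge_toN {k : ℕ} (u v : Vert k) : (toN u).Edge k (toN v) ↔ edgeRel k u v := by
  cases u <;> cases v <;> rfl

/-- In the tree with root `r` and parent function `P`, after deletion of the vertex `v` of `G_k`,
`w` is a child of `u`. -/
def NVert.Child (k : ℕ) (v r : NVert) (P : NVert → NVert) (u w : NVert) : Prop :=
  w.Valid k ∧ w ≠ v ∧ w ≠ r ∧ P w = u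

/-- Transfers `hasHIST_of_parent` to natural number indices, so that trees can be given by formulas
without bound proofs. Values of `P` at the root, at the deleted vertex and outside the graph are
irrelevant. -/
theorem hasHIST_deleteVertex {k : ℕ} (v : Vert k) (r : NVert) (P : NVert → NVert)
    (rank : NVert → ℕ) (hr : r.Valid k) (hrv : r ≠ toN v)
    (h : ∀ u : NVert, u.Valid k → u ≠ toN v → u ≠ r → (P u).Valid k ∧ P u ≠ toN v ∧
      (u.Edge k (P u) ∨ (P u).Edge k u) ∧ rank (P u) < rank u)
    (hdeg : ∀ u : NVert, u.Valid k → u ≠ toN v →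
      (u ≠ r ∧ ∀ w, ¬ NVert.Child k (toN v) r P u w) ∨
      (∃ w₁ w₂, w₁ ≠ w₂ ∧ NVert.Child k (toN v) r P u w₁ ∧ NVert.Child k (toN v) r P u w₂ ∧
        (u = r → ∃ w₃, w₃ ≠ w₁ ∧ w₃ ≠ w₂ ∧ NVert.Child k (toN v) r P u w₃))) :
    HasHIST (deleteVertex (graphG k) v) := by
  classical
  obtain ⟨r, rfl⟩ := hr.exists_toN
  have hinj := toN_injective k
  have lift : ∀ u : NVert, u.Valid k → u ≠ toN v → ∃ u' : {w : Vert k // w ≠ v}, toN u'.1 = u := by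
    intro u hu huv
    obtain ⟨u, rfl⟩ := hu.exists_toN
    exact ⟨⟨u, fun h => huv (by rw [h])⟩, rfl⟩
  have ne : ∀ u : {w : Vert k // w ≠ v}, toN u.1 ≠ toN v := fun u h => u.2 (hinj h)
  let r' : {w : Vert k // w ≠ v} := ⟨r, fun h => hrv (by rw [h])⟩
  have hr' : ∀ u : {w : Vert k // w ≠ v}, u ≠ r' ↔ toN u.1 ≠ toN r := fun u =>
    not_congr ⟨fun h => by rw [h], fun h => Subtype.ext (hinj h)⟩
  have hP : ∀ u : {w : Vert k // w ≠ v}, ∃ u' : {w : Vert k // w ≠ v}, u ≠ r' →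
      toN u'.1 = P (toN u.1) := by
    intro u
    by_cases hu : u = r'
    · exact ⟨u, fun h => absurd hu h⟩
    · obtain ⟨h₁, h₂, -⟩ := h _ (toN_valid u.1) (ne u) ((hr' u).1 hu)
      obtain ⟨u', hu'⟩ := lift _ h₁ h₂
      exact ⟨u', fun _ => hu'⟩
  choose P' hP' using hP
  have child : ∀ u w, NVert.Child k (toN v) (toN r) P (toN u) w →
      ∃ w' : {w : Vert k // w ≠ v}, toN w'.1 = w ∧ w' ≠ r' ∧ (P' w').1 = u := by
    rintro u w ⟨h₁, h₂, h₃, h₄⟩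
    obtain ⟨w', rfl⟩ := lift w h₁ h₂
    have hw := (hr' w').2 h₃
    exact ⟨w', rfl, hw, hinj ((hP' w' hw).trans h₄)⟩
  refine hasHIST_of_parent _ r' P' (fun u => rank (toN u.1)) (fun u hu => ?_) (fun u => ?_)
  · obtain ⟨-, -, h₃, h₄⟩ := h _ (toN_valid u.1) (ne u) ((hr' u).1 hu)
    rw [← hP' u hu, edge_toN, edge_toN] at h₃
    rw [← hP' u hu] at h₄
    exact ⟨graphG_adj.2 h₃, h₄⟩
  · rcases hdeg _ (toN_valid u.1) (ne u) with ⟨hu, hl⟩ | ⟨w₁, w₂, h₁₂, h₁, h₂, h₃⟩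
    · refine .inl ⟨(hr' u).2 hu, fun w hw hwu => hl (toN w.1) ⟨toN_valid _, ne w, (hr' w).1 hw, ?_⟩⟩
      rw [← hwu, hP' w hw]
    · obtain ⟨w₁, rfl, h₁, e₁⟩ := child _ _ h₁
      obtain ⟨w₂, rfl, h₂, e₂⟩ := child _ _ h₂
      refine .inr ⟨w₁, w₂, h₁, h₂, fun h => h₁₂ (by rw [h]), Subtype.ext e₁, Subtype.ext e₂, ?_⟩
      intro hu
      obtain ⟨w₃, h₃₁, h₃₂, hw₃⟩ := h₃ (by rw [hu])
      obtain ⟨w₃, rfl, h₃, e₃⟩ := child _ _ hw₃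
      exact ⟨w₃, h₃, fun h => h₃₁ (by rw [h]), fun h => h₃₂ (by rw [h]), Subtype.ext e₃⟩

/-- Spine `b 0, …, b (k-1)` rooted at its last vertex, which also carries `y`; `c i` hangs on `b
(i+1)`, and the pair `a (2m), a (2m+1)` hangs on `c (2m)`. -/
theorem hasHIST_delete_x {k : ℕ} (hk : 4 ≤ k) (hev : k % 2 = 0) :
    HasHIST (deleteVertex (graphG k) .x) := by
  refine hasHIST_deleteVertex _ (.b (k - 1))
    (fun
      | .a i => .c (2 * (i / 2))
      | .b i => .b (i + 1)
      | .c i => .b (i + 1)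
      | .x => .x
      | .y => .b (k - 1))
    (fun
      | .a _ => k + 2
      | .b i => k - i
      | _ => k + 1) ?_ ?_ ?_ ?_
  · simp [NVert.Valid]; omega
  · simp [toN]
  · rintro (i | i | i | _ | _) <;> simp [NVert.Valid, NVert.Edge, toN] <;> omega
  · rintro (i | i | i | _ | _) hi hv <;> simp only [NVert.Valid] at hi
    · refine .inl ⟨by simp, ?_⟩
      rintro (j | j | j | _ | _) <;> simp [NVert.Child, NVert.Valid, toN]
    · rcases Nat.eq_zero_or_pos i with rfl | h
      · refine .inl ⟨by simp; omega, ?_⟩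
        rintro (j | j | j | _ | _) <;> simp [NVert.Child, NVert.Valid, toN] <;> omega
      · refine .inr ⟨.b (i - 1), .c (i - 1), by simp, ?_, ?_, fun h => ⟨.y, ?_⟩⟩ <;>
          simp [NVert.Child, NVert.Valid, toN] at h ⊢ <;> omega
    · rcases Nat.mod_two_eq_zero_or_one i with h | h
      · refine .inr ⟨.a i, .a (i + 1), by simp, ?_, ?_, fun h => ?_⟩ <;>
          simp [NVert.Child, NVert.Valid, toN] at h ⊢ <;> omega
      · refine .inl ⟨by simp, ?_⟩
        rintro (j | j | j | _ | _) <;> simp [NVert.Child, NVert.Valid, toN] <;> omega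
    · simp [toN] at hv
    · refine .inl ⟨by simp, ?_⟩
      rintro (j | j | j | _ | _) <;> simp [NVert.Child, NVert.Valid, toN]

/-- The root `x` carries `a 0`, `a (k-1)` and `y`. From `y` the `b` rail is entered at both ends and
broken between `b p` and `b (p+1)`, which become leaves because `c p` is gone. The inner `a`
vertices hang in pairs on the odd `c i`, all of which survive. -/
theorem hasHIST_delete_c_even {k : ℕ} (hk : 4 ≤ k) (hev : k % 2 = 0) (p : ℕ) (hpk : p < k - 1)
    (hp : p % 2 = 0) :
    HasHIST (deleteVertex (graphG k) (.c ⟨p, hpk⟩)) := by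
  refine hasHIST_deleteVertex _ .x
    (fun
      | .a i => if i = 0 ∨ i + 1 = k then .x else .c (2 * ((i - 1) / 2) + 1)
      | .b i => if i ≤ p then if i = 0 then .y else .b (i - 1)
          else if i + 1 = k then .y else .b (i + 1)
      | .c i => if i < p then .b i else .b (i + 1)
      | .x => .x
      | .y => .x)
    (fun
      | .a _ => k + 6
      | .b i => if i ≤ p then i + 2 else k - i + 2
      | .c _ => k + 5
      | .x => 0
      | .y => 1) ?_ ?_ ?_ ?_
  · simp [NVert.Valid]
  · simp [toN]
  · rintro (i | i | i | _ | _) hi hv hr <;> simp only [NVert.Valid] at hi <;>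
      simp [toN] at hv hr ⊢ <;> (try split_ifs) <;> simp [NVert.Valid, NVert.Edge] <;> grind
  · rintro (i | i | i | _ | _) hi hv <;> simp [NVert.Valid, toN] at hi hv
    · refine .inl ⟨by simp, ?_⟩
      rintro (j | j | j | _ | _) <;> simp [NVert.Child, NVert.Valid, toN] <;> grind
    · rcases lt_or_ge i p with h | h
      · refine .inr ⟨.b (i + 1), .c i, by simp, ?_, ?_, by simp⟩ <;>
          simp [NVert.Child, NVert.Valid, toN] <;> grind
      · rcases lt_or_ge (p + 1) i with h | h
        · refine .inr ⟨.b (i - 1), .c (i - 1), by simp, ?_, ?_, by simp⟩ <;>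
            simp [NVert.Child, NVert.Valid, toN] <;> grind
        · refine .inl ⟨by simp, ?_⟩
          rintro (j | j | j | _ | _) <;> simp [NVert.Child, NVert.Valid, toN] <;> grind
    · rcases Nat.mod_two_eq_zero_or_one i with h | h
      · refine .inl ⟨by simp, ?_⟩
        rintro (j | j | j | _ | _) <;> simp [NVert.Child, NVert.Valid, toN] <;> grind
      · refine .inr ⟨.a i, .a (i + 1), by simp, ?_, ?_, by simp⟩ <;>
          simp [NVert.Child, NVert.Valid, toN] <;> grind
    · refine .inr ⟨.a 0, .a (k - 1), by simp; omega, ?_, ?_, fun _ => ⟨.y, by simp, by simp, ?_⟩⟩ <;>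
        simp [NVert.Child, NVert.Valid, toN] <;> grind
    · refine .inr ⟨.b 0, .b (k - 1), by simp; omega, ?_, ?_, by simp⟩ <;>
        simp [NVert.Child, NVert.Valid, toN] <;> grind

/-- The same broken `b` rail, now rooted at `y` with `x` as a leaf. All `a` vertices hang in pairs
on the even `c i`, all of which survive. -/
theorem hasHIST_delete_c_odd {k : ℕ} (hk : 4 ≤ k) (hev : k % 2 = 0) (p : ℕ) (hpk : p < k - 1)
    (hp : p % 2 = 1) :
    HasHIST (deleteVertex (graphG k) (.c ⟨p, hpk⟩)) := by
  refine hasHIST_deleteVertex _ .y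
    (fun
      | .a i => .c (2 * (i / 2))
      | .b i => if i ≤ p then if i = 0 then .y else .b (i - 1)
          else if i + 1 = k then .y else .b (i + 1)
      | .c i => if i < p then .b i else .b (i + 1)
      | .x => .y
      | .y => .y)
    (fun
      | .a _ => k + 6
      | .b i => if i ≤ p then i + 2 else k - i + 2
      | .c _ => k + 5
      | .x => 1
      | .y => 0) ?_ ?_ ?_ ?_
  · simp [NVert.Valid]
  · simp [toN]
  · rintro (i | i | i | _ | _) hi hv hr <;> simp only [NVert.Valid] at hi <;>
      simp [toN] at hv hr ⊢ <;> (try split_ifs) <;> simp [NVert.Valid, NVert.Edge] <;> grind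
  · rintro (i | i | i | _ | _) hi hv <;> simp [NVert.Valid, toN] at hi hv
    · refine .inl ⟨by simp, ?_⟩
      rintro (j | j | j | _ | _) <;> simp [NVert.Child, NVert.Valid, toN] <;> grind
    · rcases lt_or_ge i p with h | h
      · refine .inr ⟨.b (i + 1), .c i, by simp, ?_, ?_, by simp⟩ <;>
          simp [NVert.Child, NVert.Valid, toN] <;> grind
      · rcases lt_or_ge (p + 1) i with h | h
        · refine .inr ⟨.b (i - 1), .c (i - 1), by simp, ?_, ?_, by simp⟩ <;>
            simp [NVert.Child, NVert.Valid, toN] <;> grind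
        · refine .inl ⟨by simp, ?_⟩
          rintro (j | j | j | _ | _) <;> simp [NVert.Child, NVert.Valid, toN] <;> grind
    · rcases Nat.mod_two_eq_zero_or_one i with h | h
      · refine .inr ⟨.a i, .a (i + 1), by simp, ?_, ?_, by simp⟩ <;>
          simp [NVert.Child, NVert.Valid, toN] <;> grind
      · refine .inl ⟨by simp, ?_⟩
        rintro (j | j | j | _ | _) <;> simp [NVert.Child, NVert.Valid, toN] <;> grind
    · refine .inl ⟨by simp, ?_⟩
      rintro (j | j | j | _ | _) <;> simp [NVert.Child, NVert.Valid, toN] <;> grind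
    · refine .inr ⟨.b 0, .b (k - 1), by simp; omega, ?_, ?_, fun _ => ⟨.x, by simp, by simp, ?_⟩⟩ <;>
        simp [NVert.Child, NVert.Valid, toN] <;> grind

/-- The root `y` carries `x`, `b (k-1)` and the spine `b 0, …, b (k-2)`. The pairs `a (2m+1), a
(2m+2)` on the odd `c i` leave `a (k-1)` over; it hangs on `a (k-2)` together with `c (k-2)`, so
that `b (k-2)` can be a leaf. -/
theorem hasHIST_delete_a_zero {k : ℕ} (hk : 4 ≤ k) (hev : k % 2 = 0) :
    HasHIST (deleteVertex (graphG k) (.a ⟨0, by omega⟩)) := by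
  refine hasHIST_deleteVertex _ .y
    (fun
      | .a i => if i + 1 = k then .a (k - 2) else .c (2 * ((i - 1) / 2) + 1)
      | .b i => if i = 0 ∨ i + 1 = k then .y else .b (i - 1)
      | .c i => if i + 2 = k then .a (k - 2) else .b i
      | .x => .y
      | .y => .y)
    (fun
      | .a i => if i + 1 = k then k + 9 else k + 7
      | .b i => i + 1
      | .c i => if i + 2 = k then k + 9 else k + 5
      | .x => 1
      | .y => 0) ?_ ?_ ?_ ?_
  · simp [NVert.Valid]
  · simp [toN]
  · rintro (i | i | i | _ | _) hi hv hr <;> simp only [NVert.Valid] at hi <;>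
      simp [toN] at hv hr ⊢ <;> (try split_ifs) <;> simp [NVert.Valid, NVert.Edge] <;> grind
  · rintro (i | i | i | _ | _) hi hv <;> simp [NVert.Valid, toN] at hi hv
    · rcases eq_or_ne (i + 2) k with h | h
      · refine .inr ⟨.a (k - 1), .c (k - 2), by simp, ?_, ?_, by simp⟩ <;>
          simp [NVert.Child, NVert.Valid, toN] <;> grind
      · refine .inl ⟨by simp, ?_⟩
        rintro (j | j | j | _ | _) <;> simp [NVert.Child, NVert.Valid, toN] <;> grind
    · rcases lt_or_ge (i + 2) k with h | h
      · refine .inr ⟨.b (i + 1), .c i, by simp, ?_, ?_, by simp⟩ <;>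
          simp [NVert.Child, NVert.Valid, toN] <;> grind
      · refine .inl ⟨by simp, ?_⟩
        rintro (j | j | j | _ | _) <;> simp [NVert.Child, NVert.Valid, toN] <;> grind
    · rcases Nat.mod_two_eq_zero_or_one i with h | h
      · refine .inl ⟨by simp, ?_⟩
        rintro (j | j | j | _ | _) <;> simp [NVert.Child, NVert.Valid, toN] <;> grind
      · refine .inr ⟨.a i, .a (i + 1), by simp, ?_, ?_, by simp⟩ <;>
          simp [NVert.Child, NVert.Valid, toN] <;> grind
    · refine .inl ⟨by simp, ?_⟩
      rintro (j | j | j | _ | _) <;> simp [NVert.Child, NVert.Valid, toN] <;> grind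
    · refine .inr ⟨.b 0, .b (k - 1), by simp; omega, ?_, ?_, fun _ => ⟨.x, by simp, by simp, ?_⟩⟩ <;>
        simp [NVert.Child, NVert.Valid, toN] <;> grind

/-- The root `x` carries `y`, `a (k-1)` and `a 0`; `a 0` carries `a 1` and `c 0`, and `c 0` carries
`b 0` and the spine starting at `b 1`. The remaining `a` vertices are paired on even `c i` before
the gap at `p` and on odd `c i` behind it. -/
theorem hasHIST_delete_a_even {k : ℕ} (hk : 4 ≤ k) (hev : k % 2 = 0) (p : ℕ) (hpk : p < k)
    (hp : p % 2 = 0) (hp₀ : p ≠ 0) :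
    HasHIST (deleteVertex (graphG k) (.a ⟨p, hpk⟩)) := by
  refine hasHIST_deleteVertex _ .x
    (fun
      | .a i => if i = 0 ∨ i + 1 = k then .x else if i = 1 then .a 0 else
          if i < p then .c (2 * (i / 2)) else .c (2 * ((i - 1) / 2) + 1)
      | .b i => if i ≤ 1 then .c 0 else .b (i - 1)
      | .c i => if i = 0 then .a 0 else .b i
      | .x => .x
      | .y => .x)
    (fun
      | .a i => if i = 0 then 1 else k + 6
      | .b i => if i = 0 then 3 else i + 2
      | .c i => if i = 0 then 2 else k + 5
      | .x => 0
      | .y => 1) ?_ ?_ ?_ ?_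
  · simp [NVert.Valid]
  · simp [toN]
  · rintro (i | i | i | _ | _) hi hv hr <;> simp only [NVert.Valid] at hi <;>
      simp [toN] at hv hr ⊢ <;> (try split_ifs) <;> simp [NVert.Valid, NVert.Edge] <;> grind
  · rintro (i | i | i | _ | _) hi hv <;> simp [NVert.Valid, toN] at hi hv
    · rcases eq_or_ne i 0 with h | h
      · refine .inr ⟨.a 1, .c 0, by simp, ?_, ?_, by simp⟩ <;>
          simp [NVert.Child, NVert.Valid, toN] <;> grind
      · refine .inl ⟨by simp, ?_⟩
        rintro (j | j | j | _ | _) <;> simp [NVert.Child, NVert.Valid, toN] <;> grind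
    · rcases eq_or_ne i 0 with h | h
      · refine .inl ⟨by simp, ?_⟩
        rintro (j | j | j | _ | _) <;> simp [NVert.Child, NVert.Valid, toN] <;> grind
      · rcases lt_or_ge (i + 1) k with h | h
        · refine .inr ⟨.b (i + 1), .c i, by simp, ?_, ?_, by simp⟩ <;>
            simp [NVert.Child, NVert.Valid, toN] <;> grind
        · refine .inl ⟨by simp, ?_⟩
          rintro (j | j | j | _ | _) <;> simp [NVert.Child, NVert.Valid, toN] <;> grind
    · rcases eq_or_ne i 0 with h | h
      · refine .inr ⟨.b 0, .b 1, by simp, ?_, ?_, by simp⟩ <;>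
          simp [NVert.Child, NVert.Valid, toN] <;> grind
      · rcases Nat.mod_two_eq_zero_or_one i with h | h
        · rcases lt_or_ge i p with h | h
          · refine .inr ⟨.a i, .a (i + 1), by simp, ?_, ?_, by simp⟩ <;>
              simp [NVert.Child, NVert.Valid, toN] <;> grind
          · refine .inl ⟨by simp, ?_⟩
            rintro (j | j | j | _ | _) <;> simp [NVert.Child, NVert.Valid, toN] <;> grind
        · rcases lt_or_ge i p with h | h
          · refine .inl ⟨by simp, ?_⟩
            rintro (j | j | j | _ | _) <;> simp [NVert.Child, NVert.Valid, toN] <;> grind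
          · refine .inr ⟨.a i, .a (i + 1), by simp, ?_, ?_, by simp⟩ <;>
              simp [NVert.Child, NVert.Valid, toN] <;> grind
    · refine .inr ⟨.a 0, .a (k - 1), by simp; omega, ?_, ?_, fun _ => ⟨.y, by simp, by simp, ?_⟩⟩ <;>
        simp [NVert.Child, NVert.Valid, toN] <;> grind
    · refine .inl ⟨by simp, ?_⟩
      rintro (j | j | j | _ | _) <;> simp [NVert.Child, NVert.Valid, toN] <;> grind

theorem isK1Histonian_graphG {k : ℕ} (hk : 4 ≤ k) (hev : k % 2 = 0) : IsK1Histonian (graphG k) := by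
  have ha : ∀ i : Fin k, HasHIST (deleteVertex (graphG k) (.a i)) := by
    have even : ∀ i : Fin k, (i : ℕ) % 2 = 0 → HasHIST (deleteVertex (graphG k) (.a i)) := by
      rintro ⟨p, hpk⟩ hp
      rcases eq_or_ne p 0 with rfl | hp₀
      · exact hasHIST_delete_a_zero hk hev
      · exact hasHIST_delete_a_even hk hev p hpk hp hp₀
    intro i
    rcases Nat.mod_two_eq_zero_or_one i with h | h
    · exact even i h
    -- Since `k` is even, reversing the indices changes their parity.
    · have h' := (even i.rev (by rw [Fin.val_rev]; omega)).deleteVertex_iso (revIso k)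
      have e : revIso k (.a i.rev) = .a i := congrArg Vert.a (Fin.rev_rev i)
      rwa [e] at h'
  rintro (i | i | ⟨i, hi⟩ | _ | _)
  · exact ha i
  · exact (ha i).deleteVertex_iso (swapIso k)
  · rcases Nat.mod_two_eq_zero_or_one i with h | h
    · exact hasHIST_delete_c_even hk hev i hi h
    · exact hasHIST_delete_c_odd hk hev i hi h
  · exact hasHIST_delete_x hk hev
  · exact (hasHIST_delete_x hk hev).deleteVertex_iso (swapIso k)

/-! ### 3-connectivity of `G_k` -/

/-- The vertices of one of the two rails. -/
def rail (k : ℕ) (s : Bool) (i : ℕ) : Vert k := if s then av k i else bv k i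

/-- The vertex joining the two ends of a rail. -/
def apex {k : ℕ} (s : Bool) : Vert k := if s then .x else .y

theorem rail_ne_apex {k : ℕ} (s s' : Bool) {i : ℕ} (hi : i < k) : rail k s i ≠ apex s' := by
  cases s <;> cases s' <;> simp [rail, apex, av_eq, bv_eq, hi]

theorem cv_ne_apex {k : ℕ} (s : Bool) {i : ℕ} (hi : i + 1 < k) : cv k i ≠ apex s := by
  cases s <;> simp [apex, cv_eq (show i < k - 1 by omega)]

theorem rail_ne_cv {k : ℕ} (s : Bool) {i j : ℕ} (hi : i < k) (hj : j + 1 < k) :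
    rail k s i ≠ cv k j := by
  cases s <;> simp [rail, av_eq, bv_eq, hi, cv_eq (show j < k - 1 by omega)]

theorem cv_inj {k : ℕ} {i j : ℕ} (hi : i + 1 < k) (hj : j + 1 < k) : cv k i = cv k j ↔ i = j := by
  simp [cv_eq (show i < k - 1 by omega), cv_eq (show j < k - 1 by omega)]

theorem rail_inj {k : ℕ} (s : Bool) {i j : ℕ} (hi : i < k) (hj : j < k) :
    rail k s i = rail k s j ↔ i = j := by
  cases s <;> simp [rail, av_eq, bv_eq, hi, hj]

theorem adj_rail {k : ℕ} (s : Bool) {i : ℕ} (hi : i + 1 < k) :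
    (graphG k).Adj (rail k s i) (rail k s (i + 1)) := by
  cases s <;> simp [graphG_adj, rail, av_eq, bv_eq, hi, show i < k by omega, edgeRel]

theorem adj_cv {k : ℕ} (s : Bool) {i : ℕ} (hi : i + 1 < k) :
    (graphG k).Adj (rail k s i) (cv k i) := by
  cases s <;> simp [graphG_adj, rail, av_eq, bv_eq, cv_eq (show i < k - 1 by omega),
    show i < k by omega, edgeRel]

theorem adj_cv_succ {k : ℕ} (s : Bool) {i : ℕ} (hi : i + 1 < k) :
    (graphG k).Adj (rail k s (i + 1)) (cv k i) := by
  cases s <;> simp [graphG_adj, rail, av_eq, bv_eq, cv_eq (show i < k - 1 by omega), hi, edgeRel]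

theorem adj_apex_zero {k : ℕ} (s : Bool) (hk : 0 < k) :
    (graphG k).Adj (rail k s 0) (apex s) := by
  cases s <;> simp [graphG_adj, rail, apex, av_eq, bv_eq, hk, edgeRel]

theorem adj_apex_last {k : ℕ} (s : Bool) {i : ℕ} (hi : i + 1 = k) :
    (graphG k).Adj (rail k s i) (apex s) := by
  cases s <;> simp [graphG_adj, rail, apex, av_eq, bv_eq, show i < k by omega, edgeRel, hi]

theorem adj_apex_apex {k : ℕ} (s : Bool) : (graphG k).Adj (apex s) (apex !s) := by
  cases s <;> simp [graphG_adj, apex, edgeRel]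

theorem vert_cases {k : ℕ} (s : Bool) (v : Vert k) : (∃ i < k, v = rail k s i) ∨
    (∃ i < k, v = rail k (!s) i) ∨ (∃ i, i + 1 < k ∧ v = cv k i) ∨ v = apex s ∨ v = apex !s := by
  cases v with
  | a i =>
    have : Vert.a i = rail k true i := by simp [rail, av_eq i.2]
    cases s
    · exact .inr (.inl ⟨i, i.2, this⟩)
    · exact .inl ⟨i, i.2, this⟩
  | b i =>
    have : Vert.b i = rail k false i := by simp [rail, bv_eq i.2]
    cases s
    · exact .inl ⟨i, i.2, this⟩
    · exact .inr (.inl ⟨i, i.2, this⟩)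
  | c i => exact .inr (.inr (.inl ⟨i, by omega, by simp [cv_eq i.2]⟩))
  | x => cases s <;> simp [apex]
  | y => cases s <;> simp [apex]

/-- Being a vertex of the cycle formed by a rail and its apex. -/
def OnCycle {k : ℕ} (s : Bool) (v : Vert k) : Prop := v = apex s ∨ ∃ i < k, v = rail k s i

theorem eq_of_rail_segment {k : ℕ} {α : Type*} {S : Finset (Vert k)} {f : Vert k → α}
    (hf : ∀ u v, (graphG k).Adj u v → u ∉ S → v ∉ S → f u = f v) (s : Bool) {l m : ℕ} (hlm : l ≤ m)
    (hm : m < k) (h : ∀ i, l ≤ i → i ≤ m → rail k s i ∉ S) : f (rail k s l) = f (rail k s m) := by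
  induction m, hlm using Nat.le_induction with
  | base => rfl
  | succ m hlm ih =>
    rw [ih (by omega) fun i h₁ h₂ => h i h₁ (by omega)]
    exact hf _ _ (adj_rail s hm) (h m hlm (by omega)) (h (m + 1) (by omega) le_rfl)

/-- A cycle that loses at most one vertex stays connected. Here `f` stands for any labelling
constant along surviving edges, later the component, so no walks in induced subgraphs have to be
handled. -/
theorem eq_of_onCycle {k : ℕ} (hk : 4 ≤ k) {α : Type*} {S : Finset (Vert k)} {f : Vert k → α}
    (hf : ∀ u v, (graphG k).Adj u v → u ∉ S → v ∉ S → f u = f v) (s : Bool)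
    (h : ∀ u v, OnCycle s u → OnCycle s v → u ∈ S → v ∈ S → u = v) {u v : Vert k}
    (hu : OnCycle s u) (hv : OnCycle s v) (huS : u ∉ S) (hvS : v ∉ S) : f u = f v := by
  have rail_mem : ∀ i < k, OnCycle s (rail k s i) := fun i hi => .inr ⟨i, hi, rfl⟩
  by_cases ht : (apex s : Vert k) ∈ S
  · have hr : ∀ i < k, rail k s i ∉ S := fun i hi hS =>
      rail_ne_apex s s hi (h _ _ (rail_mem i hi) (.inl rfl) hS ht)
    have key : ∀ w, OnCycle s w → w ∉ S → f w = f (rail k s 0) := by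
      rintro w (rfl | ⟨i, hi, rfl⟩) hw
      · exact absurd ht hw
      · exact (eq_of_rail_segment hf s (Nat.zero_le i) hi fun j _ hj => hr j (by omega)).symm
    rw [key u hu huS, key v hv hvS]
  · have key : ∀ w, OnCycle s w → w ∉ S → f w = f (apex s) := by
      rintro w (rfl | ⟨i, hi, rfl⟩) hw
      · rfl
      · by_cases hj : ∀ j ≤ i, rail k s j ∉ S
        · rw [← eq_of_rail_segment hf s (Nat.zero_le i) hi fun j _ h' => hj j h']
          exact hf _ _ (adj_apex_zero s (by omega)) (hj 0 (by omega)) ht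
        · push Not at hj
          obtain ⟨j, hji, hj⟩ := hj
          have hr : ∀ m, i ≤ m → m < k → rail k s m ∉ S := by
            intro m him hm hS
            have := (rail_inj s hm (by omega)).1
              (h _ _ (rail_mem m hm) (rail_mem j (by omega)) hS hj)
            have : i = j := by omega
            exact hw (this ▸ hj)
          rw [eq_of_rail_segment hf s (show i ≤ k - 1 by omega) (by omega)
            fun m h₁ h₂ => hr m h₁ (by omega)]
          exact hf _ _ (adj_apex_last s (by omega)) (hr _ (by omega) (by omega)) ht
    rw [key u hu huS, key v hv hvS]

/-- The vertices `cv k i` and the other apex are adjacent to the intact cycle. A vertex of the other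
rail reaches it through a neighbouring `cv k i`. If that one is deleted, at most one vertex of the
other cycle is missing: either its apex survives and is reached along it, or the apex is the second
deleted vertex, and another `cv k m` is available directly or after one step along the rail. -/
theorem eq_of_cycle_disjoint {k : ℕ} (hk : 4 ≤ k) {α : Type*} {S : Finset (Vert k)} {f : Vert k → α}
    (hS : ∀ u v w, u ∈ S → v ∈ S → w ∈ S → u = v ∨ u = w ∨ v = w)
    (hf : ∀ u v, (graphG k).Adj u v → u ∉ S → v ∉ S → f u = f v) (s : Bool)
    (h : ∀ u, OnCycle s u → u ∉ S) {v : Vert k} (hv : v ∉ S) : f v = f (apex s) := by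
  have hA : ∀ i < k, f (rail k s i) = f (apex s) := fun i hi =>
    eq_of_onCycle hk hf s (fun u _ hu _ huS => absurd huS (h u hu)) (.inr ⟨i, hi, rfl⟩) (.inl rfl)
      (h _ (.inr ⟨i, hi, rfl⟩)) (h _ (.inl rfl))
  have hc : ∀ i, i + 1 < k → cv k i ∉ S → f (cv k i) = f (apex s) := fun i hi hi' => by
    rw [← hA i (by omega)]
    exact (hf _ _ (adj_cv s hi) (h _ (.inr ⟨i, by omega, rfl⟩)) hi').symm
  have ht : apex (!s) ∉ S → f (apex !s) = f (apex s) := fun ht =>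
    (hf _ _ (adj_apex_apex s) (h _ (.inl rfl)) ht).symm
  have h₁ : ∀ i, i + 1 < k → rail k (!s) i ∉ S → cv k i ∉ S → f (rail k (!s) i) = f (apex s) :=
    fun i hi hr hc' => (hf _ _ (adj_cv _ hi) hr hc').trans (hc i hi hc')
  have h₂ : ∀ i, i + 1 < k → rail k (!s) (i + 1) ∉ S → cv k i ∉ S →
      f (rail k (!s) (i + 1)) = f (apex s) :=
    fun i hi hr hc' => (hf _ _ (adj_cv_succ _ hi) hr hc').trans (hc i hi hc')
  have h₃ : ∀ i j, i < k → j + 1 < k → rail k (!s) i ∉ S → cv k j ∈ S → apex (!s) ∉ S →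
      f (rail k (!s) i) = f (apex s) := by
    intro i j hi hj hr hcj hts
    rw [← ht hts]
    refine eq_of_onCycle hk hf (!s) ?_ (.inr ⟨i, hi, rfl⟩) (.inl rfl) hr hts
    have hne : ∀ u, OnCycle (!s) u → u ≠ cv k j := by
      rintro u (rfl | ⟨m, hm, rfl⟩)
      · exact (cv_ne_apex _ hj).symm
      · exact rail_ne_cv _ hm hj
    intro u v hu hv huS hvS
    rcases hS u v _ huS hvS hcj with h | h | h
    · exact h
    · exact absurd h (hne u hu)
    · exact absurd h (hne v hv)
  have h₄ : ∀ j m, j + 1 < k → m + 1 < k → cv k j ∈ S → apex (!s) ∈ S → j ≠ m → cv k m ∉ S := by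
    intro j m hj hm hjS htS hjm hmS
    rcases hS _ _ _ hjS hmS htS with h | h | h
    · exact hjm ((cv_inj hj hm).1 h)
    · exact cv_ne_apex _ hj h
    · exact cv_ne_apex _ hm h
  have h₅ : ∀ j m, j + 1 < k → m < k → cv k j ∈ S → apex (!s) ∈ S → rail k (!s) m ∉ S := by
    intro j m hj hm hjS htS hmS
    rcases hS _ _ _ hjS hmS htS with h | h | h
    · exact rail_ne_cv _ hm hj h.symm
    · exact cv_ne_apex _ hj h
    · exact rail_ne_apex _ _ hm h
  rcases vert_cases s v with ⟨i, hi, rfl⟩ | ⟨i, hi, rfl⟩ | ⟨i, hi, rfl⟩ | rfl | rfl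
  · exact hA i hi
  · rcases Nat.lt_or_ge (i + 1) k with hik | hik
    · by_cases hci : cv k i ∈ S
      · by_cases hts : apex (!s) ∈ S
        · rcases i with _ | i
          · rw [hf _ _ (adj_rail (!s) hik) hv (h₅ 0 1 hik hik hci hts)]
            exact h₁ 1 (by omega) (h₅ 0 1 hik hik hci hts)
              (h₄ 0 1 hik (by omega) hci hts (by omega))
          · exact h₂ i hi hv (h₄ (i + 1) i hik hi hci hts (by omega))
        · exact h₃ i i hi hik hv hci hts
      · exact h₁ i hik hv hci
    · obtain ⟨m, rfl⟩ : ∃ m, i = m + 2 := ⟨i - 2, by omega⟩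
      by_cases hci : cv k (m + 1) ∈ S
      · by_cases hts : apex (!s) ∈ S
        · have hr := h₅ (m + 1) (m + 1) hi (by omega) hci hts
          rw [← hf _ _ (adj_rail (!s) hi) hr hv]
          exact h₂ m (by omega) hr (h₄ (m + 1) m hi (by omega) hci hts (by omega))
        · exact h₃ _ (m + 1) hi hi hv hci hts
      · exact h₂ (m + 1) hi hv hci
  · exact hc i hi hv
  · rfl
  · exact ht hv

/-- If both cycles meet `S`, each does so in exactly one vertex and no `cv k i` is deleted. Every
`cv k i` has two neighbours on each cycle, one of which survives. -/
theorem eq_of_card_lt_three {k : ℕ} (hk : 4 ≤ k) {α : Type*} {S : Finset (Vert k)} {f : Vert k → α}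
    (hcard : S.card < 3) (hf : ∀ u v, (graphG k).Adj u v → u ∉ S → v ∉ S → f u = f v)
    {u v : Vert k} (hu : u ∉ S) (hv : v ∉ S) : f u = f v := by
  have hS : ∀ u v w, u ∈ S → v ∈ S → w ∈ S → u = v ∨ u = w ∨ v = w := by
    intro u v w hu hv hw
    by_contra! h
    exact absurd (Finset.two_lt_card.2 ⟨u, hu, v, hv, w, hw, h.1, h.2.1, h.2.2⟩) (by omega)
  by_cases hT : ∃ s, ∀ u : Vert k, OnCycle s u → u ∉ S
  · obtain ⟨s, hs⟩ := hT
    rw [eq_of_cycle_disjoint hk hS hf s hs hu, eq_of_cycle_disjoint hk hS hf s hs hv]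
  · push Not at hT
    have hdisj : ∀ (s : Bool) (u v : Vert k), OnCycle s u → OnCycle (!s) v → u ≠ v := by
      rintro s u v (rfl | ⟨i, hi, rfl⟩) (rfl | ⟨j, hj, rfl⟩)
      · cases s <;> simp [apex]
      · exact (rail_ne_apex _ _ hj).symm
      · exact rail_ne_apex _ _ hi
      · cases s <;> simp [rail, av_eq, bv_eq, hi, hj]
    have hone : ∀ (s : Bool) (u v : Vert k), OnCycle s u → OnCycle s v → u ∈ S → v ∈ S → u = v := by
      intro s u v hu hv huS hvS
      obtain ⟨w, hw, hwS⟩ := hT !s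
      rcases hS u v w huS hvS hwS with h | h | h
      · exact h
      · exact absurd h (hdisj s u w hu hw)
      · exact absurd h (hdisj s v w hv hw)
    have hcS : ∀ i, i + 1 < k → cv k i ∉ S := by
      intro i hi hiS
      have hne : ∀ (s : Bool) (u : Vert k), OnCycle s u → u ≠ cv k i := by
        rintro s u (rfl | ⟨m, hm, rfl⟩)
        · exact (cv_ne_apex _ hi).symm
        · exact rail_ne_cv _ hm hi
      obtain ⟨u, hu, huS⟩ := hT true
      obtain ⟨w, hw, hwS⟩ := hT false
      rcases hS _ _ _ huS hwS hiS with h | h | h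
      · exact hdisj true u w hu hw h
      · exact hne _ _ hu h
      · exact hne _ _ hw h
    have hcyc : ∀ (s : Bool) (i : ℕ), i + 1 < k → ∀ u, OnCycle s u → u ∉ S → f (cv k i) = f u := by
      intro s i hi u hu huS
      by_cases h₀ : rail k s i ∈ S
      · have h₁ : rail k s (i + 1) ∉ S := by
          intro h₁
          have := (rail_inj s (by omega) (by omega)).1
            (hone s _ _ (.inr ⟨i, by omega, rfl⟩) (.inr ⟨i + 1, hi, rfl⟩) h₀ h₁)
          omega
        rw [← hf _ _ (adj_cv_succ s hi) h₁ (hcS i hi)]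
        exact eq_of_onCycle hk hf s (hone s) (.inr ⟨i + 1, hi, rfl⟩) hu h₁ huS
      · rw [← hf _ _ (adj_cv s hi) h₀ (hcS i hi)]
        exact eq_of_onCycle hk hf s (hone s) (.inr ⟨i, by omega, rfl⟩) hu h₀ huS
    have key : ∀ u, u ∉ S → f u = f (cv k 0) := by
      intro u hu
      rcases vert_cases true u with ⟨i, hi, rfl⟩ | ⟨i, hi, rfl⟩ | ⟨i, hi, rfl⟩ | rfl | rfl
      · exact (hcyc true 0 (by omega) _ (.inr ⟨i, hi, rfl⟩) hu).symm
      · exact (hcyc false 0 (by omega) _ (.inr ⟨i, hi, rfl⟩) hu).symm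
      · obtain ⟨w, hw, hwS⟩ : ∃ w : Vert k, OnCycle true w ∧ w ∉ S := by
          by_cases h₀ : rail k true 0 ∈ S
          · refine ⟨apex true, .inl rfl, fun h₁ => rail_ne_apex true true (by omega)
              (hone true _ _ (.inr ⟨0, by omega, rfl⟩) (.inl rfl) h₀ h₁)⟩
          · exact ⟨_, .inr ⟨0, by omega, rfl⟩, h₀⟩
        rw [hcyc true i hi w hw hwS, hcyc true 0 (by omega) w hw hwS]
      · exact (hcyc true 0 (by omega) _ (.inl rfl) hu).symm
      · exact (hcyc false 0 (by omega) _ (.inl rfl) hu).symm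
    rw [key u hu, key v hv]

theorem isVertexConnected_graphG {k : ℕ} (hk : 4 ≤ k) : IsVertexConnected 3 (graphG k) := by
  classical
  refine ⟨?_, fun S hS => ?_⟩
  · rw [ENat.card_eq_coe_natCard, card_vert (by omega)]
    exact_mod_cast (by omega : 3 < 3 * k + 1)
  · let f : Vert k → Option ((graphG k).induce {v : Vert k | v ∉ S}).ConnectedComponent := fun u =>
      if h : u ∉ S then some (SimpleGraph.connectedComponentMk _ ⟨u, h⟩) else none
    have hf : ∀ u v, (graphG k).Adj u v → u ∉ S → v ∉ S → f u = f v := by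
      intro u v huv hu hv
      simp only [f, hu, hv, not_false_eq_true, dite_true, Option.some.injEq]
      exact component_eq huv
    have hne : ∃ v, v ∉ S := by
      by_contra! h
      have h₁ := Finset.card_eq_iff_eq_univ S |>.2 (Finset.eq_univ_iff_forall.2 h)
      rw [← Nat.card_eq_fintype_card, card_vert (by omega)] at h₁
      omega
    obtain ⟨v, hv⟩ := hne
    exact
      { preconnected := by
          rintro ⟨u, hu⟩ ⟨w, hw⟩
          have h := eq_of_card_lt_three hk hS hf hu hw
          have hu' : u ∉ S := hu
          have hw' : w ∉ S := hw
          simp only [f, hu', hw', not_false_eq_true, dite_true, Option.some.injEq] at h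
          exact SimpleGraph.ConnectedComponent.exact h
        nonempty := ⟨⟨v, hv⟩⟩ }

/-! ### A straight-line drawing of `H_k` -/

/-- A graph is planar if it has a straight-line drawing in which every vertex on an edge is an end
of it and common points of different edges are vertices. -/
theorem isPlanar_of_straight {V : Type*} (G : SimpleGraph V) (X Y : V → ℝ)
    (hinj : ∀ u v, X u = X v → Y u = Y v → u = v) (R : V → V → Prop)
    (hR : ∀ u v, G.Adj u v → R u v ∨ R v u)
    (hvert : ∀ u v w, R u v → ∀ t : ℝ, 0 ≤ t → t ≤ 1 → X w = X u + t * (X v - X u) →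
      Y w = Y u + t * (Y v - Y u) → w = u ∨ w = v)
    (hcross : ∀ u v u' v', R u v → R u' v' → s(u, v) ≠ s(u', v') → ∀ t t' : ℝ, 0 ≤ t → t ≤ 1 →
      0 ≤ t' → t' ≤ 1 → X u + t * (X v - X u) = X u' + t' * (X v' - X u') →
      Y u + t * (Y v - Y u) = Y u' + t' * (Y v' - Y u') →
      ∃ w, X w = X u + t * (X v - X u) ∧ Y w = Y u + t * (Y v - Y u)) : IsPlanar G := by
  let pos : V → EuclideanSpace ℝ (Fin 2) := fun v => !₂[X v, Y v]
  have hpos : ∀ p : EuclideanSpace ℝ (Fin 2), ∀ w, X w = p 0 → Y w = p 1 → pos w = p := by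
    intro p w h₀ h₁
    ext i
    fin_cases i
    · exact h₀
    · exact h₁
  have hpinj : Function.Injective pos := by
    intro u v h
    exact hinj u v (congrArg (fun p : EuclideanSpace ℝ (Fin 2) => p 0) h)
      (congrArg (fun p : EuclideanSpace ℝ (Fin 2) => p 1) h)
  let arc : Sym2 V → Set (EuclideanSpace ℝ (Fin 2)) :=
    Sym2.lift ⟨fun u v => segment ℝ (pos u) (pos v), fun u v => segment_symm _ _ _⟩
  have harc : ∀ e ∈ G.edgeSet, ∃ u v, e = s(u, v) ∧ R u v := by
    intro e he
    induction e with
    | _ u v =>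
      rcases hR u v he with h | h
      · exact ⟨u, v, rfl, h⟩
      · exact ⟨v, u, Sym2.eq_swap, h⟩
  have hseg : ∀ u v p, p ∈ arc s(u, v) → ∃ t : ℝ, 0 ≤ t ∧ t ≤ 1 ∧
      p 0 = X u + t * (X v - X u) ∧ p 1 = Y u + t * (Y v - Y u) := by
    intro u v p hp
    have hp : p ∈ segment ℝ (pos u) (pos v) := hp
    rw [segment_eq_image'] at hp
    obtain ⟨t, ⟨h₀, h₁⟩, rfl⟩ := hp
    exact ⟨t, h₀, h₁, by simp [pos], by simp [pos]⟩
  have hvert' : ∀ e ∈ G.edgeSet, ∀ w, pos w ∈ arc e → w ∈ e := by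
    intro e he w hw
    obtain ⟨u, v, rfl, huv⟩ := harc e he
    obtain ⟨t, h₀, h₁, hx, hy⟩ := hseg _ _ _ hw
    exact Sym2.mem_iff.2 (hvert u v w huv t h₀ h₁ hx hy)
  refine ⟨pos, arc, hpinj, ?_, hvert', ?_⟩
  · intro u v huv
    exact ⟨Path.segment (pos u) (pos v), Path.segment_injective_of_ne (hpinj.ne huv.ne),
      Path.range_segment _ _⟩
  · rintro e he f hf hef p ⟨hpe, hpf⟩
    -- It suffices that the common point is some vertex: by `hvert'` it is then an end of both
    -- edges.
    have : ∃ w, pos w = p := by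
      obtain ⟨u, v, rfl, huv⟩ := harc e he
      obtain ⟨u', v', rfl, huv'⟩ := harc f hf
      obtain ⟨t, h₀, h₁, hx, hy⟩ := hseg _ _ _ hpe
      obtain ⟨t', h₀', h₁', hx', hy'⟩ := hseg _ _ _ hpf
      obtain ⟨w, hw, hw'⟩ := hcross u v u' v' huv huv' hef t t' h₀ h₁ h₀' h₁' (hx.symm.trans hx')
        (hy.symm.trans hy')
      exact ⟨w, hpos p w (hw.trans hx.symm) (hw'.trans hy.symm)⟩
    obtain ⟨w, rfl⟩ := this
    exact ⟨w, hvert' e he w hpe, hvert' f hf w hpf, rfl⟩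

theorem IsPlanar.mono {V : Type*} {G G' : SimpleGraph V} (hle : G ≤ G') (h : IsPlanar G') :
    IsPlanar G := by
  obtain ⟨pos, arc, h₁, h₂, h₃, h₄⟩ := h
  have hE := SimpleGraph.edgeSet_mono hle
  exact ⟨pos, arc, h₁, fun u v huv => h₂ u v (hle huv), fun e he => h₃ e (hE he),
    fun e he f hf => h₄ e (hE he) f (hE hf)⟩

/-- The distance of the vertices of the rails from the middle line in the drawing. -/
noncomputable def railHeight (k i : ℕ) : ℝ := if i = 0 ∨ i + 1 = k then 2 else 1

/-- The first coordinate of the vertices in the drawing. -/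
def xCoord {k : ℕ} : Vert k → ℝ
  | .a i => 2 * (i : ℕ)
  | .b i => 2 * (i : ℕ)
  | .c i => 2 * (i : ℕ) + 1
  | .x => -1
  | .y => -1

/-- The second coordinate of the vertices in the drawing. -/
noncomputable def yCoord {k : ℕ} : Vert k → ℝ
  | .a i => railHeight k i
  | .b i => -railHeight k i
  | .c _ => 0
  | .x => 3
  | .y => -3

/-- The sign of the half-plane that contains a rail. -/
def railSign (s : Bool) : ℝ := if s then 1 else -1

theorem railHeight_cases (k i : ℕ) : railHeight k i = 1 ∨ railHeight k i = 2 := by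
  unfold railHeight
  split_ifs <;> simp

theorem xCoord_rail {k : ℕ} (s : Bool) {i : ℕ} (hi : i < k) : xCoord (rail k s i) = 2 * i := by
  cases s <;> simp [rail, av_eq, bv_eq, hi, xCoord]

theorem yCoord_rail {k : ℕ} (s : Bool) {i : ℕ} (hi : i < k) :
    yCoord (rail k s i) = railSign s * railHeight k i := by
  cases s <;> simp [rail, av_eq, bv_eq, hi, yCoord, railSign]

theorem xCoord_cv {k i : ℕ} (hi : i + 1 < k) : xCoord (cv k i) = 2 * i + 1 := by
  simp [cv_eq (show i < k - 1 by omega), xCoord]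

theorem yCoord_cv {k i : ℕ} (hi : i + 1 < k) : yCoord (cv k i) = 0 := by
  simp [cv_eq (show i < k - 1 by omega), yCoord]

theorem xCoord_apex {k : ℕ} (s : Bool) : xCoord (apex s : Vert k) = -1 := by
  cases s <;> simp [apex, xCoord]

theorem yCoord_apex {k : ℕ} (s : Bool) : yCoord (apex s : Vert k) = railSign s * 3 := by
  cases s <;> simp [apex, yCoord, railSign]

/-- The edges of `H_k`, each listed in one direction. -/
inductive DrawnEdge (k : ℕ) : Vert k → Vert k → Prop
  | along (s : Bool) (i : ℕ) (hi : i + 1 < k) : DrawnEdge k (rail k s i) (rail k s (i + 1))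
  | left (s : Bool) (i : ℕ) (hi : i + 1 < k) : DrawnEdge k (rail k s i) (cv k i)
  | right (s : Bool) (i : ℕ) (hi : i + 1 < k) : DrawnEdge k (rail k s (i + 1)) (cv k i)
  | first (s : Bool) : DrawnEdge k (rail k s 0) (apex s)
  | last (s : Bool) : DrawnEdge k (rail k s (k - 1)) (apex s)
  | apexes : DrawnEdge k (apex true) (apex false)
  | chord : DrawnEdge k (rail k true 0) (rail k true (k - 1))

theorem drawnEdge_of_edgeRel {k : ℕ} {u v : Vert k} (h : edgeRel k u v) : DrawnEdge k u v := by
  have ha : ∀ i : Fin k, Vert.a i = rail k true i := fun i => by simp [rail, av_eq i.2]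
  have hb : ∀ i : Fin k, Vert.b i = rail k false i := fun i => by simp [rail, bv_eq i.2]
  have hc : ∀ i : Fin (k - 1), Vert.c i = cv k i := fun i => by simp [cv_eq i.2]
  rcases u with i | i | i | _ | _ <;> rcases v with j | j | j | _ | _ <;> simp only [edgeRel] at h
  · rw [ha, ha, h]; exact .along true i (by omega)
  · rw [ha, hc]
    rcases h with h | h
    · rw [h]; exact .left true j (by omega)
    · rw [h]; exact .right true j (by omega)
  · rw [ha]
    rcases h with h | h
    · rw [h]; exact .first true
    · rw [show (i : ℕ) = k - 1 by omega]; exact .last true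
  · rw [hb, hb, h]; exact .along false i (by omega)
  · rw [hb, hc]
    rcases h with h | h
    · rw [h]; exact .left false j (by omega)
    · rw [h]; exact .right false j (by omega)
  · rw [hb]
    rcases h with h | h
    · rw [h]; exact .first false
    · rw [show (i : ℕ) = k - 1 by omega]; exact .last false
  · exact .apexes

/-- What has to be known about the points `(px, py)` of an edge `uv` in the drawing. -/
inductive OnEdge (k : ℕ) (u v : Vert k) (px py : ℝ) : Prop
  | strip (s : Bool) (i : ℕ) (hi : i + 1 < k) (h₀ : 0 ≤ railSign s * py)
      (h₂ : railSign s * py ≤ 2) (hl : 2 * (i : ℝ) ≤ px) (hr : px ≤ 2 * (i : ℝ) + 2)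
      (hE : py = 0 ∨ railSign s * py = 2 ∨ px = 2 * i ∨ px = 2 * i + 2 →
        (px = xCoord u ∧ py = yCoord u) ∨ (px = xCoord v ∧ py = yCoord v))
      (hkind : (u = rail k s i ∧ v = rail k s (i + 1) ∧
          railHeight k i - (px - 2 * i) / 2 ≤ railSign s * py ∧
          railHeight k (i + 1) - (2 * i + 2 - px) / 2 ≤ railSign s * py) ∨
        (u = rail k s i ∧ v = cv k i ∧ px ≤ 2 * i + 1 ∧
          railSign s * py ≤ railHeight k i - (px - 2 * i) ∧ (px = 2 * i + 1 → py = 0)) ∨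
        (u = rail k s (i + 1) ∧ v = cv k i ∧ 2 * i + 1 ≤ px ∧
          railSign s * py ≤ railHeight k (i + 1) - (2 * i + 2 - px)))
  | top (s : Bool) (h₂ : 2 ≤ railSign s * py) (hl : -1 ≤ px)
      (hE : px = -1 ∨ railSign s * py = 2 ∧ (px = 0 ∨ px = 2 * k - 2) →
        (px = xCoord u ∧ py = yCoord u) ∨ (px = xCoord v ∧ py = yCoord v))
      (hkind : (u = rail k s 0 ∧ v = apex s ∧ px = 2 - railSign s * py) ∨
        (u = rail k s (k - 1) ∧ v = apex s ∧ 5 - 2 * (railSign s * py) ≤ px ∧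
          (railSign s * py = 2 → px = 2 * k - 2)) ∨
        (u = rail k true 0 ∧ v = rail k true (k - 1) ∧ s = true ∧ py = 2 ∧ 0 ≤ px))
  | middle (hu : u = apex true) (hv : v = apex false) (hx : px = -1)

theorem railSign_mul_lerp (s : Bool) (a b t : ℝ) :
    railSign s * (railSign s * a + t * (railSign s * b - railSign s * a)) = a + t * (b - a) := by
  cases s <;> simp only [railSign, Bool.false_eq_true, if_true, if_false] <;> ring

theorem railSign_mul_lerp_zero (s : Bool) (a t : ℝ) :
    railSign s * (railSign s * a + t * (0 - railSign s * a)) = a - t * a := by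
  cases s <;> simp only [railSign, Bool.false_eq_true, if_true, if_false] <;> ring

/-- Two consecutive rail vertices are never both at height 2, so an edge along a rail touches that
level only at an end, and its slope is at most one half in absolute value. -/
theorem railHeight_pair {k i : ℕ} (hk : 4 ≤ k) :
    railHeight k i = 1 ∧ railHeight k (i + 1) = 1 ∨ railHeight k i = 2 ∧ railHeight k (i + 1) = 1 ∨
      railHeight k i = 1 ∧ railHeight k (i + 1) = 2 := by
  unfold railHeight
  split_ifs <;> norm_num
  rename_i h₁ h₂
  rcases h₂ with h | h
  · exact h
  · omega

theorem railHeight_zero (k : ℕ) : railHeight k 0 = 2 := by simp [railHeight]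

theorem railHeight_last {k : ℕ} (hk : 4 ≤ k) : railHeight k (k - 1) = 2 := by
  simp [railHeight, show k - 1 + 1 = k by omega]

theorem eq_zero_of_railSign_mul {s : Bool} {p : ℝ} (h : railSign s * p = 0) : p = 0 := by
  cases s <;> simpa [railSign] using h

/-- Rail edges have slope at most one half, while edges to the axis fall with slope at least one;
this gives the separating inequalities in a strip. Above height 2, the line through `(-1, 3)` and
`(1, 2)` separates the two edges at an apex. The sign `railSign s` treats both half-planes at once.
-/
theorem DrawnEdge.onEdge {k : ℕ} (hk : 4 ≤ k) {u v : Vert k} (h : DrawnEdge k u v) {t : ℝ}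
    (h₀ : 0 ≤ t) (h₁ : t ≤ 1) {px py : ℝ} (hx : px = xCoord u + t * (xCoord v - xCoord u))
    (hy : py = yCoord u + t * (yCoord v - yCoord u)) : OnEdge k u v px py := by
  have hk' : (4 : ℝ) ≤ k := by exact_mod_cast hk
  cases h with
  | along s i hi =>
    rw [xCoord_rail s hi, xCoord_rail s (show i < k by omega)] at hx
    rw [yCoord_rail s hi, yCoord_rail s (show i < k by omega)] at hy
    have hq := congrArg (railSign s * ·) hy
    simp only [railSign_mul_lerp] at hq
    push_cast at hx
    have hE : t = 0 ∨ t = 1 → (px = xCoord (rail k s i) ∧ py = yCoord (rail k s i)) ∨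
        (px = xCoord (rail k s (i + 1)) ∧ py = yCoord (rail k s (i + 1))) := by
      rw [xCoord_rail s hi, xCoord_rail s (show i < k by omega), yCoord_rail s hi,
        yCoord_rail s (show i < k by omega), hx, hy]
      rintro (rfl | rfl)
      · left; constructor <;> ring
      · right; constructor <;> push_cast <;> ring
    have hz : py = 0 → railSign s * py = 0 := fun h => by rw [h, mul_zero]
    rcases railHeight_pair (i := i) hk with ⟨e₁, e₂⟩ | ⟨e₁, e₂⟩ | ⟨e₁, e₂⟩ <;> rw [e₁, e₂] at hq <;>
    · refine .strip s i hi (by linarith) (by linarith) (by linarith) (by linarith)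
        (fun h => hE ?_) (.inl ⟨rfl, rfl, by linarith, by linarith⟩)
      rcases h with h | h | h | h
      · have := hz h
        exfalso; linarith
      · first
        | (exfalso; linarith)
        | (left; linarith)
        | (right; linarith)
      · left; linarith
      · right; linarith
  | left s i hi =>
    rw [xCoord_rail s (show i < k by omega), xCoord_cv hi] at hx
    rw [yCoord_rail s (show i < k by omega), yCoord_cv hi] at hy
    have hq := congrArg (railSign s * ·) hy
    simp only [railSign_mul_lerp_zero] at hq
    have hE : t = 0 ∨ t = 1 → (px = xCoord (rail k s i) ∧ py = yCoord (rail k s i)) ∨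
        (px = xCoord (cv k i) ∧ py = yCoord (cv k i)) := by
      rw [xCoord_cv hi, xCoord_rail s (show i < k by omega), yCoord_cv hi,
        yCoord_rail s (show i < k by omega), hx, hy]
      rintro (rfl | rfl)
      · left; constructor <;> ring
      · right; constructor <;> ring
    have hz : py = 0 → railSign s * py = 0 := fun h => by rw [h, mul_zero]
    rcases railHeight_cases k i with e | e <;> rw [e] at hq <;>
    · refine .strip s i hi (by linarith) (by linarith) (by linarith) (by linarith)
        (fun h => hE ?_) (.inr (.inl ⟨rfl, rfl, by linarith, by linarith, fun h => ?_⟩))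
      · rcases h with h | h | h | h
        · have := hz h
          right; linarith
        · left; linarith
        · left; linarith
        · exfalso; linarith
      · exact eq_zero_of_railSign_mul (s := s) (by linarith)
  | right s i hi =>
    rw [xCoord_rail s hi, xCoord_cv hi] at hx
    rw [yCoord_rail s hi, yCoord_cv hi] at hy
    have hq := congrArg (railSign s * ·) hy
    simp only [railSign_mul_lerp_zero] at hq
    push_cast at hx
    have hE : t = 0 ∨ t = 1 → (px = xCoord (rail k s (i + 1)) ∧ py = yCoord (rail k s (i + 1))) ∨
        (px = xCoord (cv k i) ∧ py = yCoord (cv k i)) := by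
      rw [xCoord_cv hi, xCoord_rail s hi, yCoord_cv hi, yCoord_rail s hi, hx, hy]
      rintro (rfl | rfl)
      · left; constructor <;> push_cast <;> ring
      · right; constructor <;> ring
    have hz : py = 0 → railSign s * py = 0 := fun h => by rw [h, mul_zero]
    rcases railHeight_cases k (i + 1) with e | e <;> rw [e] at hq <;>
    · refine .strip s i hi (by linarith) (by linarith) (by linarith) (by linarith)
        (fun h => hE ?_) (.inr (.inr ⟨rfl, rfl, by linarith, by linarith⟩))
      rcases h with h | h | h | h
      · have := hz h
        right; linarith
      · left; linarith
      · exfalso; linarith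
      · left; linarith
  | first s =>
    rw [xCoord_rail s (show 0 < k by omega), xCoord_apex] at hx
    rw [yCoord_rail s (show 0 < k by omega), yCoord_apex, railHeight_zero] at hy
    have hq := congrArg (railSign s * ·) hy
    simp only [railSign_mul_lerp] at hq
    push_cast at hx
    have hE : t = 0 ∨ t = 1 → (px = xCoord (rail k s 0) ∧ py = yCoord (rail k s 0)) ∨
        (px = xCoord (apex s : Vert k) ∧ py = yCoord (apex s : Vert k)) := by
      rw [xCoord_apex, xCoord_rail s (show 0 < k by omega), yCoord_apex,
        yCoord_rail s (show 0 < k by omega), railHeight_zero, hx, hy]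
      rintro (rfl | rfl)
      · left; constructor <;> push_cast <;> ring
      · right; constructor <;> ring
    refine .top s (by linarith) (by linarith) (fun h => hE ?_) (.inl ⟨rfl, rfl, by linarith⟩)
    rcases h with h | ⟨h, -⟩
    · right; linarith
    · left; linarith
  | last s =>
    rw [xCoord_rail s (show k - 1 < k by omega), xCoord_apex, Nat.cast_sub (by omega)] at hx
    rw [yCoord_rail s (show k - 1 < k by omega), yCoord_apex, railHeight_last hk] at hy
    have hq := congrArg (railSign s * ·) hy
    simp only [railSign_mul_lerp] at hq
    push_cast at hx
    have hE : t = 0 ∨ t = 1 → (px = xCoord (rail k s (k - 1)) ∧ py = yCoord (rail k s (k - 1))) ∨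
        (px = xCoord (apex s : Vert k) ∧ py = yCoord (apex s : Vert k)) := by
      rw [xCoord_apex, xCoord_rail s (show k - 1 < k by omega), yCoord_apex,
        yCoord_rail s (show k - 1 < k by omega), railHeight_last hk, Nat.cast_sub (by omega), hx, hy]
      rintro (rfl | rfl)
      · left; constructor <;> push_cast <;> ring
      · right; constructor <;> ring
    -- This product is `px - (5 - 2 * (railSign s * py))`, so its sign is the separating inequality.
    have hp : 0 ≤ (1 - t) * (2 * k - 3) := mul_nonneg (by linarith) (by linarith)
    refine .top s (by linarith) (by linarith) (fun h => hE ?_)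
      (.inr (.inl ⟨rfl, rfl, by linarith, fun h => ?_⟩))
    · rcases h with h | ⟨h, -⟩
      · right
        have : (1 - t) * (2 * k - 1) = 0 := by linarith
        rcases mul_eq_zero.1 this with h | h <;> linarith
      · left; linarith
    · have : t = 0 := by linarith
      rw [hx, this]; ring
  | apexes => exact .middle rfl rfl (by rw [hx, xCoord_apex, xCoord_apex]; ring)
  | chord =>
    rw [xCoord_rail _ (show k - 1 < k by omega), xCoord_rail _ (show 0 < k by omega),
      Nat.cast_sub (by omega)] at hx
    rw [yCoord_rail _ (show k - 1 < k by omega), yCoord_rail _ (show 0 < k by omega),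
      railHeight_zero, railHeight_last hk] at hy
    have hq : railSign true * py = 2 := by rw [hy, railSign_mul_lerp]; ring
    have hpy : py = 2 := by simpa [railSign] using hq
    push_cast at hx
    have hp : 0 ≤ t * (2 * k - 2) := mul_nonneg h₀ (by linarith)
    refine .top true hq.ge (by linarith) ?_ (.inr (.inr ⟨rfl, rfl, rfl, hpy, by linarith⟩))
    rw [xCoord_rail _ (show k - 1 < k by omega), xCoord_rail _ (show 0 < k by omega),
      Nat.cast_sub (by omega), yCoord_rail _ (show k - 1 < k by omega),
      yCoord_rail _ (show 0 < k by omega), railHeight_zero, railHeight_last hk]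
    rintro (h | ⟨-, h | h⟩)
    · exfalso; linarith
    · left; exact ⟨by push_cast; linarith, by simp [railSign, hpy]⟩
    · right; exact ⟨by push_cast; linarith, by simp [railSign, hpy]⟩

/-- Edges from different regions can meet only where `hE` forces an end of one of them. Within one
region the inequalities in `hkind` push a common point of two different edges to such a place. -/
theorem exists_vertex_of_onEdge {k : ℕ} {u v u' v' : Vert k} {px py : ℝ}
    (h : OnEdge k u v px py) (h' : OnEdge k u' v' px py) (hne : s(u, v) ≠ s(u', v')) :
    ∃ w : Vert k, xCoord w = px ∧ yCoord w = py := by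
  have hV : ∀ {u v : Vert k}, (px = xCoord u ∧ py = yCoord u) ∨ (px = xCoord v ∧ py = yCoord v) →
      ∃ w : Vert k, xCoord w = px ∧ yCoord w = py := by
    rintro u v (⟨h₁, h₂⟩ | ⟨h₁, h₂⟩)
    · exact ⟨u, h₁.symm, h₂.symm⟩
    · exact ⟨v, h₁.symm, h₂.symm⟩
  have hneg : ∀ {s s' : Bool}, s ≠ s' → railSign s' * py = -(railSign s * py) := by
    intro s s' h
    cases s <;> cases s' <;> simp [railSign] at h ⊢
  have strip_top : ∀ {s s' : Bool}, 0 ≤ railSign s * py → railSign s * py ≤ 2 →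
      2 ≤ railSign s' * py → railSign s * py = 2 := by
    intro s s' h₀ h₂ h
    rcases eq_or_ne s s' with rfl | hs
    · exact le_antisymm h₂ h
    · rw [hneg hs] at h; linarith
  cases h with
  | strip s i hi h₀ h₂ hl hr hE hkind =>
    cases h' with
    | strip s' i' hi' h₀' h₂' hl' hr' hE' hkind' =>
      rcases eq_or_ne s s' with rfl | hs
      · rcases lt_trichotomy i i' with hii | rfl | hii
        · have : (i : ℝ) + 1 ≤ i' := by exact_mod_cast hii
          exact hV (hE (.inr (.inr (.inr (by linarith)))))
        · rcases hkind with ⟨rfl, rfl, a₁, a₂⟩ | ⟨rfl, rfl, a₁, a₂, a₃⟩ | ⟨rfl, rfl, a₁, a₂⟩ <;>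
            rcases hkind' with ⟨rfl, rfl, b₁, b₂⟩ | ⟨rfl, rfl, b₁, b₂, b₃⟩ | ⟨rfl, rfl, b₁, b₂⟩
          · exact absurd rfl hne
          · exact hV (hE (.inr (.inr (.inl (by linarith)))))
          · exact hV (hE (.inr (.inr (.inr (by linarith)))))
          · exact hV (hE (.inr (.inr (.inl (by linarith)))))
          · exact absurd rfl hne
          · exact hV (hE (.inl (a₃ (by linarith))))
          · exact hV (hE (.inr (.inr (.inr (by linarith)))))
          · exact hV (hE (.inl (b₃ (by linarith))))
          · exact absurd rfl hne
        · have : (i' : ℝ) + 1 ≤ i := by exact_mod_cast hii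
          exact hV (hE (.inr (.inr (.inl (by linarith)))))
      · rw [hneg hs] at h₀'
        exact hV (hE (.inl (eq_zero_of_railSign_mul (s := s) (by linarith))))
    | top s' h₂' hl' hE' hkind' => exact hV (hE (.inr (.inl (strip_top h₀ h₂ h₂'))))
    | middle hu hv hx =>
      have : (0 : ℝ) ≤ i := Nat.cast_nonneg i
      exfalso; linarith
  | top s h₂ hl hE hkind =>
    cases h' with
    | strip s' i' hi' h₀' h₂' hl' hr' hE' hkind' =>
      exact hV (hE' (.inr (.inl (strip_top h₀' h₂' h₂))))
    | top s' h₂' hl' hE' hkind' =>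
      rcases eq_or_ne s s' with rfl | hs
      · rcases hkind with ⟨rfl, rfl, a₁⟩ | ⟨rfl, rfl, a₁, a₂⟩ | ⟨rfl, rfl, rfl, a₁, a₂⟩ <;>
          rcases hkind' with ⟨rfl, rfl, b₁⟩ | ⟨rfl, rfl, b₁, b₂⟩ | ⟨rfl, rfl, hs, b₁, b₂⟩
        · exact absurd rfl hne
        · exact hV (hE (.inl (by linarith)))
        · subst hs
          have e : railSign true * py = 2 := by simp [railSign, b₁]
          exact hV (hE (.inr ⟨e, .inl (by linarith)⟩))
        · exact hV (hE (.inl (by linarith)))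
        · exact absurd rfl hne
        · subst hs
          have e : railSign true * py = 2 := by simp [railSign, b₁]
          exact hV (hE (.inr ⟨e, .inr (a₂ e)⟩))
        · have e : railSign true * py = 2 := by simp [railSign, a₁]
          exact hV (hE (.inr ⟨e, .inl (by linarith)⟩))
        · have e : railSign true * py = 2 := by simp [railSign, a₁]
          exact hV (hE (.inr ⟨e, .inr (b₂ e)⟩))
        · exact absurd rfl hne
      · rw [hneg hs] at h₂'
        exfalso; linarith
    | middle hu hv hx => exact hV (hE (.inl hx))
  | middle hu hv hx =>
    cases h' with
    | strip s' i' hi' h₀' h₂' hl' hr' hE' hkind' =>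
      have : (0 : ℝ) ≤ i' := Nat.cast_nonneg i'
      exfalso; linarith
    | top s' h₂' hl' hE' hkind' => exact hV (hE' (.inl hx))
    | middle hu' hv' hx' => exact absurd (by rw [hu, hv, hu', hv']) hne

theorem vert_induction {k : ℕ} (w : Vert k) : (∃ s i, i < k ∧ w = rail k s i) ∨
    (∃ i, i + 1 < k ∧ w = cv k i) ∨ ∃ s, w = apex s := by
  rcases vert_cases true w with ⟨i, hi, h⟩ | ⟨i, hi, h⟩ | h | h | h
  · exact .inl ⟨_, i, hi, h⟩
  · exact .inl ⟨_, i, hi, h⟩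
  · exact .inr (.inl h)
  · exact .inr (.inr ⟨_, h⟩)
  · exact .inr (.inr ⟨_, h⟩)

theorem railSign_mul_railSign (s s' : Bool) (r : ℝ) :
    s = s' ∧ railSign s * (railSign s' * r) = r ∨
      s ≠ s' ∧ railSign s * (railSign s' * r) = -r := by
  cases s <;> cases s' <;> simp [railSign]

theorem coord_injective {k : ℕ} {u v : Vert k} (hx : xCoord u = xCoord v)
    (hy : yCoord u = yCoord v) : u = v := by
  have hpos : ∀ i, 0 < railHeight k i := fun i => by
    rcases railHeight_cases k i with h | h <;> rw [h] <;> norm_num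
  have parity : ∀ i j : ℕ, 2 * (i : ℝ) ≠ 2 * j + 1 := fun i j h => by
    have : 2 * i = 2 * j + 1 := by exact_mod_cast h
    omega
  have nonneg : ∀ i : ℕ, (0 : ℝ) ≤ i := fun i => Nat.cast_nonneg i
  rcases u with i | i | i | _ | _ <;> rcases v with j | j | j | _ | _ <;>
    simp only [xCoord, yCoord] at hx hy
  · simp only [mul_eq_mul_left_iff, Nat.cast_inj, OfNat.ofNat_ne_zero, or_false] at hx
    rw [Fin.ext hx]
  · linarith [hpos i, hpos j]
  · exact absurd hx (parity _ _)
  · linarith [nonneg i]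
  · linarith [nonneg i]
  · linarith [hpos i, hpos j]
  · simp only [mul_eq_mul_left_iff, Nat.cast_inj, OfNat.ofNat_ne_zero, or_false] at hx
    rw [Fin.ext hx]
  · exact absurd hx (parity _ _)
  · linarith [nonneg i]
  · linarith [nonneg i]
  · exact absurd hx.symm (parity _ _)
  · exact absurd hx.symm (parity _ _)
  · simp only [add_left_inj, mul_eq_mul_left_iff, Nat.cast_inj, OfNat.ofNat_ne_zero,
      or_false] at hx
    rw [Fin.ext hx]
  · linarith [nonneg i]
  · linarith [nonneg i]
  · linarith [nonneg j]
  · linarith [nonneg j]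
  · linarith [nonneg j]
  · rfl
  · linarith
  · linarith [nonneg j]
  · linarith [nonneg j]
  · linarith [nonneg j]
  · linarith
  · rfl

/-- Vertices lying in a strip or top region satisfy a boundary condition of `hE`: `cv k j` is on the
axis, rail vertices are on strip borders or, at height 2, at the two ends, and the apexes have
abscissa `-1`. On the line between the apexes there are no other vertices. -/
theorem eq_end_of_onEdge {k : ℕ} {u v w : Vert k}
    (h : OnEdge k u v (xCoord w) (yCoord w)) : w = u ∨ w = v := by
  have hend : (xCoord w = xCoord u ∧ yCoord w = yCoord u) ∨
      (xCoord w = xCoord v ∧ yCoord w = yCoord v) → w = u ∨ w = v := by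
    rintro (⟨h₁, h₂⟩ | ⟨h₁, h₂⟩)
    · exact .inl (coord_injective h₁ h₂)
    · exact .inr (coord_injective h₁ h₂)
  have nonneg : ∀ i : ℕ, (0 : ℝ) ≤ i := fun i => Nat.cast_nonneg i
  cases h with
  | strip s i hi h₀ h₂ hl hr hE hkind =>
    refine hend (hE ?_)
    rcases vert_induction w with ⟨s', j, hj, rfl⟩ | ⟨j, hj, rfl⟩ | ⟨s', rfl⟩
    · rw [xCoord_rail _ hj] at hl hr ⊢
      have hl : i ≤ j := by exact_mod_cast (by linarith : (i : ℝ) ≤ j)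
      have hr : j ≤ i + 1 := by exact_mod_cast (by linarith : (j : ℝ) ≤ i + 1)
      rcases (by omega : j = i ∨ j = i + 1) with rfl | rfl
      · exact .inr (.inr (.inl rfl))
      · exact .inr (.inr (.inr (by push_cast; ring)))
    · exact .inl (yCoord_cv hj)
    · rw [xCoord_apex] at hl
      have := nonneg i
      exfalso; linarith
  | top s h₂ hl hE hkind =>
    refine hend (hE ?_)
    rcases vert_induction w with ⟨s', j, hj, rfl⟩ | ⟨j, hj, rfl⟩ | ⟨s', rfl⟩
    · rw [yCoord_rail _ hj] at h₂ ⊢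
      have hh : railHeight k j = 1 ∨ railHeight k j = 2 := railHeight_cases k j
      rcases railSign_mul_railSign s s' (railHeight k j) with ⟨rfl, e⟩ | ⟨-, e⟩
      · rw [e] at h₂ ⊢
        have e₂ : railHeight k j = 2 := by rcases hh with h | h <;> linarith
        refine .inr ⟨e₂, ?_⟩
        rw [xCoord_rail _ hj]
        have hj' : j = 0 ∨ j + 1 = k := by
          by_contra hcon
          rw [railHeight, if_neg hcon] at e₂
          norm_num at e₂
        rcases hj' with rfl | rfl
        · left; simp
        · right; push_cast; ring
      · rw [e] at h₂
        exfalso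
        rcases hh with h | h <;> linarith
    · rw [yCoord_cv hj] at h₂
      exfalso; linarith
    · exact .inl (xCoord_apex s')
  | middle hu hv hx =>
    rcases vert_induction w with ⟨s', j, hj, rfl⟩ | ⟨j, hj, rfl⟩ | ⟨s', rfl⟩
    · rw [xCoord_rail _ hj] at hx
      have := nonneg j
      exfalso; linarith
    · rw [xCoord_cv hj] at hx
      have := nonneg j
      exfalso; linarith
    · cases s'
      · exact .inr hv.symm
      · exact .inl hu.symm

theorem isPlanar_graphH {k : ℕ} (hk : 4 ≤ k) : IsPlanar (graphH hk) := by
  refine isPlanar_of_straight _ xCoord yCoord (fun u v => coord_injective) (DrawnEdge k) ?_ ?_ ?_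
  · intro u v huv
    have hchord : DrawnEdge k (aFirst hk) (aLast hk) := by
      have h₀ : aFirst hk = rail k true 0 := by simp [rail, aFirst, av_eq (show 0 < k by omega)]
      have h₁ : aLast hk = rail k true (k - 1) := by
        simp [rail, aLast, av_eq (show k - 1 < k by omega)]
      rw [h₀, h₁]
      exact .chord
    rcases (graphH_adj hk).1 huv with h | h | ⟨rfl, rfl⟩ | ⟨rfl, rfl⟩
    · exact .inl (drawnEdge_of_edgeRel h)
    · exact .inr (drawnEdge_of_edgeRel h)
    · exact .inl hchord
    · exact .inr hchord
  · intro u v w huv t h₀ h₁ hx hy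
    exact eq_end_of_onEdge (huv.onEdge hk h₀ h₁ hx hy)
  · intro u v u' v' huv huv' hne t t' h₀ h₁ h₀' h₁' hx hy
    exact exists_vertex_of_onEdge (huv.onEdge hk h₀ h₁ rfl rfl)
      (huv'.onEdge hk h₀' h₁' hx hy) hne

/-! ### Assembly -/

theorem isHISTCritical_graphG {k : ℕ} (hk : 4 ≤ k) (hev : Even k) : IsHISTCritical (graphG k) :=
  ⟨⟨.x⟩, fun h => not_hasHIST_graphH hk hev (h.mono (graphG_le_graphH hk)),
    isK1Histonian_graphG hk (Nat.even_iff.1 hev)⟩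

theorem isHISTCritical_graphH {k : ℕ} (hk : 4 ≤ k) (hev : Even k) :
    IsHISTCritical (graphH hk) :=
  ⟨⟨.x⟩, not_hasHIST_graphH hk hev,
    (isK1Histonian_graphG hk (Nat.even_iff.1 hev)).mono (graphG_le_graphH hk)⟩

theorem isEmpty_iso_of_ne {k l : ℕ} (hk : 1 ≤ k) (hl : 1 ≤ l) (h : k ≠ l)
    (G : SimpleGraph (Vert k)) (G' : SimpleGraph (Vert l)) : IsEmpty (G ≃g G') := by
  refine ⟨fun φ => h ?_⟩
  have := Nat.card_congr φ.toEquiv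
  rw [card_vert hk, card_vert hl] at this
  omega

theorem adj_aFirst_aLast {k : ℕ} (hk : 4 ≤ k) :
    s(aFirst hk, aLast hk) ∈ (graphH hk).edgeSet :=
  (graphH_adj hk).2 (.inr (.inr (.inl ⟨rfl, rfl⟩)))

end HIST

theorem theorem2 :
    -- infinitely many planar HIST-critical graphs
    (∃ (V : ℕ → Type) (G : ∀ n, SimpleGraph (V n)),
      (∀ m n, m ≠ n → IsEmpty (G m ≃g G n)) ∧
      ∀ n, Finite (V n) ∧ HIST.IsPlanar (G n) ∧ HIST.IsHISTCritical (G n)) ∧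
    -- infinitely many that have an edge whose deletion leaves a 3-connected HIST-critical graph
    (∃ (V : ℕ → Type) (G : ∀ n, SimpleGraph (V n)),
      (∀ m n, m ≠ n → IsEmpty (G m ≃g G n)) ∧
      ∀ n, Finite (V n) ∧ HIST.IsPlanar (G n) ∧ HIST.IsHISTCritical (G n) ∧
        ∃ e ∈ (G n).edgeSet,
          HIST.IsVertexConnected 3 ((G n).deleteEdges {e}) ∧
          HIST.IsHISTCritical ((G n).deleteEdges {e})) ∧
    -- the explicit families
    (∀ (k : ℕ) (hk : 4 ≤ k), Even k →
      (HIST.IsPlanar (HIST.graphG k) ∧ HIST.IsHISTCritical (HIST.graphG k) ∧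
        HIST.IsVertexConnected 3 (HIST.graphG k)) ∧
      (HIST.IsPlanar (HIST.graphH hk) ∧ HIST.IsHISTCritical (HIST.graphH hk)) ∧
      (s(HIST.aFirst hk, HIST.aLast hk) ∈ (HIST.graphH hk).edgeSet ∧
        (HIST.graphH hk).deleteEdges {s(HIST.aFirst hk, HIST.aLast hk)} = HIST.graphG k) ∧
      (Nat.card (HIST.Vert k) = 3 * k + 1 ∧
        {v | HIST.deg (HIST.graphG k) v ≠ 4} =
          {HIST.aFirst hk, HIST.aLast hk, HIST.bFirst hk, HIST.bLast hk, .x, .y} ∧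
        {v | HIST.deg (HIST.graphH hk) v ≠ 4} =
          {HIST.bFirst hk, HIST.bLast hk, .x, .y})) := by
  have hk : ∀ n : ℕ, 4 ≤ 2 * n + 4 := fun n => by omega
  have hev : ∀ n : ℕ, Even (2 * n + 4) := fun n => ⟨n + 2, by ring⟩
  refine ⟨⟨fun n => HIST.Vert (2 * n + 4), fun n => HIST.graphG (2 * n + 4), ?_, ?_⟩,
    ⟨fun n => HIST.Vert (2 * n + 4), fun n => HIST.graphH (hk n), ?_, ?_⟩, ?_⟩
  · exact fun m n h => HIST.isEmpty_iso_of_ne (by omega) (by omega) (by omega) _ _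
  · exact fun n => ⟨inferInstance,
      (HIST.isPlanar_graphH (hk n)).mono (HIST.graphG_le_graphH (hk n)),
      HIST.isHISTCritical_graphG (hk n) (hev n)⟩
  · exact fun m n h => HIST.isEmpty_iso_of_ne (by omega) (by omega) (by omega) _ _
  · refine fun n => ⟨inferInstance, HIST.isPlanar_graphH (hk n),
      HIST.isHISTCritical_graphH (hk n) (hev n), _, HIST.adj_aFirst_aLast (hk n), ?_⟩
    rw [HIST.deleteEdges_graphH]
    exact ⟨HIST.isVertexConnected_graphG (hk n), HIST.isHISTCritical_graphG (hk n) (hev n)⟩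
  · exact fun k hk hev =>
      ⟨⟨(HIST.isPlanar_graphH hk).mono (HIST.graphG_le_graphH hk),
        HIST.isHISTCritical_graphG hk hev, HIST.isVertexConnected_graphG hk⟩,
        ⟨HIST.isPlanar_graphH hk, HIST.isHISTCritical_graphH hk hev⟩,
        ⟨HIST.adj_aFirst_aLast hk, HIST.deleteEdges_graphH hk⟩,
        HIST.card_vert (by omega), HIST.deg_graphG_ne_four hk, HIST.deg_graphH_ne_four hk⟩
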